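/- Let $1\le \ell<n$ be integers and let $\alpha,\beta,\sigma\in\mathbb R$. Write $x=(x_i^j)$, $1\le i\le \ell$, $1\le j\le n-\ell$, for the elements of $\mathbb R^{\ell(n-\ell)}$, and define linear maps $P_x:\mathbb R^n\to\mathbb R^\ell$ and $T_x:\mathbb R^\ell\to\mathbb R^{n-\ell}$ by $$(P_xp)_i=p_i+\sum_{j=1}^{n-\ell}x_i^j\,p_{\ell+j},\qquad (T_x\xi)_j=\sum_{i=1}^{\ell}x_i^j\,\xi_i .$$ A set $F\subset\mathbb R^\ell$ is said to have Sobolev dimension at least $\sigma$ if $F$ carries a Borel probability measure $\nu$ (that is, $\nu(\mathbb R^\ell\setminus F)=0$) such that $$\int_{\mathbb R^\ell}|\widehat\nu(\xi)|^2\,\frac{d\xi}{(1+|\xi|)^{\ell-\sigma}}<\infty,\qquad \widehat\nu(\xi)=\int e^{-2\pi i\langle\xi,y\rangle}\,d\nu(y).$$ Let $\lambda$ be a compactly supported nonnegative Borel measure on $\mathbb R^{\ell(n-\ell)}$ for which there is a constant $c>0$ with $$\lambda\big(\{x\in\mathbb R^{\ell(n-\ell)}:|T_x\xi-p_2|\le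 r\}\big)\le c\,r^\beta$$ for all $\xi\in\mathbb R^\ell$ with $|\xi|=1$, all $p_2\in\mathbb R^{n-\ell}$ and all $r>0$. Let $E\subset\mathbb R^n$ be a nonempty Borel set with Hausdorff dimension at least $\alpha$, and suppose that $$n-\ell+\sigma-\alpha<\beta .$$ Then for $\lambda$-almost every $x\in\mathbb R^{\ell(n-\ell)}$, the set $P_x(E)\subset\mathbb R^\ell$ has Sobolev dimension at least $\sigma$. -/

import Mathlib

open MeasureTheory
open scoped ENNReal InnerProductSpace

noncomputable section

namespace ExceptionalProj

/-- The linear map `P_x : ℝⁿ → ℝ^ℓ` given by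
`(P_x p)_i = p_i + ∑_{j=1}^{n-ℓ} x_i^j p_{ℓ+j}`, for a parameter
`x = (x_i^j) ∈ ℝ^{ℓ(n-ℓ)}` whose entry `x_i^j` is `x (i, j)`. -/
def projMap {n ℓ : ℕ} (h : ℓ ≤ n) (x : EuclideanSpace ℝ (Fin ℓ × Fin (n - ℓ)))
    (p : EuclideanSpace ℝ (Fin n)) : EuclideanSpace ℝ (Fin ℓ) :=
  WithLp.toLp 2 fun i : Fin ℓ =>
    p ⟨i.1, by omega⟩ + ∑ j : Fin (n - ℓ), x (i, j) * p ⟨ℓ + j.1, by omega⟩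

/-- The linear map `T_x : ℝ^ℓ → ℝ^{n-ℓ}` given by `(T_x ξ)_j = ∑_{i=1}^ℓ x_i^j ξ_i`. -/
def dualMap {n ℓ : ℕ} (x : EuclideanSpace ℝ (Fin ℓ × Fin (n - ℓ)))
    (ξ : EuclideanSpace ℝ (Fin ℓ)) : EuclideanSpace ℝ (Fin (n - ℓ)) :=
  WithLp.toLp 2 fun j : Fin (n - ℓ) => ∑ i : Fin ℓ, x (i, j) * ξ i

/-- The Fourier transform `ξ ↦ ∫ e^{-2πi⟨ξ,y⟩} dν(y)` of a measure on `ℝ^ℓ`. -/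
def measureFourier {ℓ : ℕ} (ν : Measure (EuclideanSpace ℝ (Fin ℓ)))
    (ξ : EuclideanSpace ℝ (Fin ℓ)) : ℂ :=
  ∫ y, Complex.exp (-2 * (Real.pi : ℂ) * Complex.I * ((⟪ξ, y⟫_ℝ : ℝ) : ℂ)) ∂ν

/-- `F ⊆ ℝ^ℓ` has Sobolev dimension at least `σ`: it carries a Borel probability measure `ν`
with `∫ |ν̂(ξ)|² (1+|ξ|)^{-(ℓ-σ)} dξ < ∞`. The set `F` need not be Borel; that `F` carries `ν`
means that the complement of `F` is a `ν`-null set. -/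
def SobolevDimGE {ℓ : ℕ} (F : Set (EuclideanSpace ℝ (Fin ℓ))) (σ : ℝ) : Prop :=
  ∃ ν : Measure (EuclideanSpace ℝ (Fin ℓ)), IsProbabilityMeasure ν ∧ ν Fᶜ = 0 ∧
    ∫⁻ ξ : EuclideanSpace ℝ (Fin ℓ),
      ENNReal.ofReal (‖measureFourier ν ξ‖ ^ 2 / (1 + ‖ξ‖) ^ ((ℓ : ℝ) - σ)) < ∞

end ExceptionalProj

end

noncomputable section

namespace ExceptionalProj

open Set Filter Topology

/-! The Fourier transform of the image of `μ` under `P_x` at `ξ` is `μ̂(ξ, T_x ξ)`, because `ξ ↦ (ξ,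
T_x ξ)` is the adjoint of `P_x` (`measureFourier_map_projMap`). With `a = σ - ℓ - β` it therefore
suffices to find `μ` on a compact subset of `E` for which the average over `λ` of `∫ (1+|ξ|)^(a+β)
|μ̂(ξ, T_x ξ)|² dξ` is finite.

The hypothesis on the exponents reads `a + n < α`. A Frostman-type lemma
(`exists_measure_prod_dist_le`) gives a probability measure `μ` with `(μ×μ){|p-q| ≤ r} ≲ r^t` for
some `t > a + n`, and testing `|μ̂|²` against Gaussians at dyadic scales turns this into `∫
(1+|η|)^a |μ̂(η)|² dη < ∞` (`lintegral_fourier_energy_lt_top`).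

To pass from `ℝⁿ` to the graphs of the `T_x`, multiply `μ` by a Gaussian, which keeps its null sets.
This convolves `μ̂` with a Gaussian, so by Jensen the new `|μ̂|²` is at most a Gaussian average of
the old one. After Tonelli the weight at `η = (η₁, η₂)` is `∫∫ (1+|ξ|)^(a+β) exp(-π|(ξ, T_x ξ) -
η|²) dλ(x) dξ`. The Gaussian localizes `ξ` near `η₁` and `T_x ξ` near `η₂`. By homogeneity the
second condition has `λ`-mass `≲ |ξ|^(-β)`, and boundedness of the support of `λ` makes `|ξ|` and
`|η|` comparable up to factors that the Gaussian absorbs. Hence the weight is `≲ (1+|η|)^a`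
(`lintegral_kernel_le`) and the average energy is finite.

Frostman's lemma for Borel `E` is obtained from an `ℓ²`-capacity built on dyadic bumps. Uniform
convexity of the norm gives continuity along increasing unions, hence Choquet's inner regularity by
compact sets (`exists_isCompact_capGE`). Hahn–Banach turns positive capacity of a compact set into a
measure of finite dyadic energy (`exists_measure_of_capGE`), and a set of zero capacity can be
covered so economically that its Hausdorff measure vanishes. -/

/-- Nonnegative `f ∈ ℓ²(ι)` whose potential `∑ f i * ψ i` is at least one on `A`. -/
def Admissible {X ι : Type*} (ψ : ι → X → ℝ) (A : Set X) : Set (lp (fun _ : ι => ℝ) 2) :=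
  {f | (∀ i, 0 ≤ f i) ∧ ∀ x ∈ A, 1 ≤ ∑' i, ENNReal.ofReal (f i * ψ i x)}

/-- The square root of the `ℓ²`-capacity of `A` is at least `c`. -/
def CapGE {X ι : Type*} (ψ : ι → X → ℝ) (A : Set X) (c : ℝ) : Prop :=
  ∀ f ∈ Admissible ψ A, c ≤ ‖f‖

/-! ### The `ℓ²`-capacity and its continuity along increasing unions. -/

section Capacity

variable {X ι : Type*} {ψ : ι → X → ℝ}

theorem admissible_anti {A B : Set X} (h : A ⊆ B) : Admissible ψ B ⊆ Admissible ψ A :=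
  fun _ hf => ⟨hf.1, fun x hx => hf.2 x (h hx)⟩

theorem admissible_of_le (hψ : ∀ i x, 0 ≤ ψ i x) {A : Set X} {f g : lp (fun _ : ι => ℝ) 2}
    (hf : f ∈ Admissible ψ A) (h : ∀ i, f i ≤ g i) : g ∈ Admissible ψ A :=
  ⟨fun i => (hf.1 i).trans (h i), fun x hx => (hf.2 x hx).trans <|
    ENNReal.tsum_le_tsum fun i => ENNReal.ofReal_le_ofReal <|
      mul_le_mul_of_nonneg_right (h i) (hψ i x)⟩

theorem admissible_midpoint (hψ : ∀ i x, 0 ≤ ψ i x) {A : Set X} {f g : lp (fun _ : ι => ℝ) 2}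
    (hf : f ∈ Admissible ψ A) (hg : g ∈ Admissible ψ A) :
    (2⁻¹ : ℝ) • (f + g) ∈ Admissible ψ A := by
  refine ⟨fun i => ?_, fun x hx => ?_⟩
  · have := hf.1 i
    have := hg.1 i
    simp only [lp.coeFn_smul, lp.coeFn_add, Pi.smul_apply, Pi.add_apply, smul_eq_mul]
    positivity
  · have key : ∀ i, ENNReal.ofReal (((2⁻¹ : ℝ) • (f + g)) i * ψ i x) =
        2⁻¹ * (ENNReal.ofReal (f i * ψ i x) + ENNReal.ofReal (g i * ψ i x)) := by
      intro i
      rw [← ENNReal.ofReal_add (mul_nonneg (hf.1 i) (hψ i x)) (mul_nonneg (hg.1 i) (hψ i x))]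
      have : (2⁻¹ : ℝ≥0∞) = ENNReal.ofReal 2⁻¹ := by
        rw [ENNReal.ofReal_inv_of_pos (by norm_num)]; simp
      rw [this, ← ENNReal.ofReal_mul (by norm_num)]
      simp only [lp.coeFn_smul, lp.coeFn_add, Pi.smul_apply, Pi.add_apply, smul_eq_mul]
      ring_nf
    simp_rw [key]
    rw [ENNReal.tsum_mul_left, ENNReal.tsum_add]
    calc (1 : ℝ≥0∞) = 2⁻¹ * (1 + 1) := by
          rw [one_add_one_eq_two, ENNReal.inv_mul_cancel (by simp) (by simp)]
      _ ≤ _ := by gcongr; exacts [hf.2 x hx, hg.2 x hx]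

/-- The coordinatewise absolute value on `ℓ²`. -/
def lpAbs (f : lp (fun _ : ι => ℝ) 2) : lp (fun _ : ι => ℝ) 2 :=
  ⟨fun i => |f i|, (memℓp_gen_iff (by norm_num)).2 (by
    simpa using (memℓp_gen_iff (by norm_num)).1 (lp.memℓp f))⟩

@[simp] theorem lpAbs_apply (f : lp (fun _ : ι => ℝ) 2) (i : ι) : lpAbs f i = |f i| := rfl

@[simp] theorem norm_lpAbs (f : lp (fun _ : ι => ℝ) 2) : ‖lpAbs f‖ = ‖f‖ := by
  rw [lp.norm_eq_tsum_rpow (by norm_num), lp.norm_eq_tsum_rpow (by norm_num)]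
  simp

/-- Near-minimizers of the norm in a decreasing sequence of midpoint convex sets are Cauchy. -/
theorem exists_cauchySeq_of_midpoint {H : Type*} [NormedAddCommGroup H] [InnerProductSpace ℝ H]
    (S : ℕ → Set H) (hS : Antitone S)
    (hmid : ∀ k, ∀ f ∈ S k, ∀ g ∈ S k, (2⁻¹ : ℝ) • (f + g) ∈ S k) {c : ℝ}
    (hne : ∀ k, ∃ f ∈ S k, ‖f‖ < c) :
    ∃ g : ℕ → H, (∀ k, g k ∈ S k) ∧ CauchySeq g ∧ ∃ m ≤ c, Tendsto (fun k => ‖g k‖) atTop (𝓝 m) := by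
  set m : ℕ → ℝ := fun k => sInf (norm '' S k) with hm
  have hbdd : ∀ k, BddBelow (norm '' S k) := fun k => ⟨0, by rintro _ ⟨f, _, rfl⟩; positivity⟩
  have hSne : ∀ k, (norm '' S k).Nonempty := fun k => by
    obtain ⟨f, hf, _⟩ := hne k
    exact ⟨_, f, hf, rfl⟩
  have hmc : ∀ k, m k ≤ c := fun k => by
    obtain ⟨f, hf, hfc⟩ := hne k
    exact (csInf_le (hbdd k) ⟨f, hf, rfl⟩).trans hfc.le
  have hm0 : ∀ k, 0 ≤ m k := fun k =>
    le_csInf (hSne k) (by rintro _ ⟨f, _, rfl⟩; positivity)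
  have hmono : Monotone m := fun k l hkl =>
    csInf_le_csInf (hbdd k) (hSne l) (image_mono (hS hkl))
  have hmle : ∀ k, ∀ f ∈ S k, m k ≤ ‖f‖ := fun k f hf => csInf_le (hbdd k) ⟨f, hf, rfl⟩
  have hlim : Tendsto m atTop (𝓝 (⨆ k, m k)) :=
    tendsto_atTop_ciSup hmono ⟨c, by rintro _ ⟨k, rfl⟩; exact hmc k⟩
  have hex : ∀ k : ℕ, ∃ f ∈ S k, ‖f‖ < m k + 1 / ((k : ℝ) + 1) := fun k => by
    obtain ⟨_, ⟨f, hf, rfl⟩, h⟩ := exists_lt_of_csInf_lt (hSne k)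
      (lt_add_of_pos_right (m k) (Nat.one_div_pos_of_nat (n := k)))
    exact ⟨f, hf, h⟩
  choose g hgS hg using hex
  have hgm : Tendsto (fun k => ‖g k‖) atTop (𝓝 (⨆ k, m k)) := by
    refine tendsto_of_tendsto_of_tendsto_of_le_of_le hlim ?_ (fun k => hmle k _ (hgS k))
      (fun k => (hg k).le)
    simpa using hlim.add (tendsto_one_div_add_atTop_nhds_zero_nat (𝕜 := ℝ))
  refine ⟨g, hgS, ?_, _, ciSup_le hmc, hgm⟩
  set M := ⨆ k, m k
  have hkey : ∀ k l, k ≤ l → ‖g k - g l‖ ^ 2 ≤ 2 * ‖g k‖ ^ 2 + 2 * ‖g l‖ ^ 2 - 4 * m k ^ 2 := by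
    intro k l hkl
    -- The midpoint of `g k` and `g l` still lies in the larger set `S k`, so its norm is at least
    -- `m k`; the parallelogram law then bounds the difference.
    have h1 := hmle k _ (hmid k _ (hgS k) _ (hS hkl (hgS l)))
    rw [norm_smul, Real.norm_of_nonneg (by norm_num)] at h1
    have h2 := parallelogram_law_with_norm ℝ (g k) (g l)
    nlinarith [hm0 k, norm_nonneg (g k + g l)]
  refine Metric.cauchySeq_iff'.2 fun ε hε => ?_
  have e1 : ∀ᶠ k in atTop, ‖g k‖ ^ 2 < M ^ 2 + ε ^ 2 / 16 :=
    (hgm.pow 2).eventually_lt_const (by nlinarith)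
  have e2 : ∀ᶠ k in atTop, M ^ 2 - ε ^ 2 / 16 < m k ^ 2 :=
    (hlim.pow 2).eventually_const_lt (by nlinarith)
  obtain ⟨N, hN⟩ := (e1.and e2).exists_forall_of_atTop
  refine ⟨N, fun l hl => ?_⟩
  rw [dist_comm, dist_eq_norm]
  have h1 := hkey N l hl
  have h2 := hN N le_rfl
  have h3 := hN l hl
  exact lt_of_pow_lt_pow_left₀ 2 hε.le (by nlinarith)

/-- Upper bounds for the capacity pass to increasing unions. -/
theorem exists_admissible_iUnion (hψ : ∀ i x, 0 ≤ ψ i x) (A : ℕ → Set X) (hA : Monotone A)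
    {c c' : ℝ} (hc : c < c') (h : ∀ k, ∃ f ∈ Admissible ψ (A k), ‖f‖ < c) :
    ∃ f ∈ Admissible ψ (⋃ k, A k), ‖f‖ < c' := by
  obtain ⟨g, hgA, hg, m, hmc, hm⟩ := exists_cauchySeq_of_midpoint (fun k => Admissible ψ (A k))
    (fun k l hkl => admissible_anti (hA hkl)) (fun k f hf g hg => admissible_midpoint hψ hf hg) h
  obtain ⟨g', hg'⟩ := cauchySeq_tendsto_of_complete hg
  have hg'n : ‖g'‖ = m := tendsto_nhds_unique hg'.norm hm
  set ε := (c' - c) / 4 with hε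
  have hε0 : 0 < ε := by rw [hε]; linarith
  have hsub : ∀ j : ℕ, ∃ k, j ≤ k ∧ ‖g k - g'‖ < ε * (1 / 2) ^ j := fun j => by
    have := (tendsto_iff_norm_sub_tendsto_zero.1 hg').eventually_lt_const
      (show 0 < ε * (1 / 2) ^ j by positivity)
    obtain ⟨k, hk⟩ := ((eventually_ge_atTop j).and this).exists
    exact ⟨k, hk⟩
  choose φ hφj hφ using hsub
  have hgeo : HasSum (fun j : ℕ => ε * (1 / 2) ^ j) (ε * 2) := hasSum_geometric_two.mul_left ε
  have hsum : Summable fun j => ‖lpAbs (g (φ j) - g')‖ := by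
    refine Summable.of_nonneg_of_le (fun _ => norm_nonneg _) (fun j => ?_) hgeo.summable
    simpa using (hφ j).le
  have hsum' := hsum.of_norm
  -- Norm convergence need not preserve the pointwise condition on potentials. Adding all the errors
  -- of a rapidly convergent subsequence gives a majorant of every `g (φ j)`, which is admissible
  -- for every `A j` and costs at most `2ε < c' - c` in norm.
  refine ⟨lpAbs g' + ∑' j, lpAbs (g (φ j) - g'), ?_, ?_⟩
  · have hcoord : ∀ i, HasSum (fun j => |g (φ j) i - g' i|)
        ((∑' j, lpAbs (g (φ j) - g') : lp (fun _ : ι => ℝ) 2) i) := by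
      intro i
      have := hsum'.hasSum.map (lp.evalCLM ℝ (fun _ : ι => ℝ) 2 i : _ →+ ℝ)
        (lp.evalCLM ℝ (fun _ : ι => ℝ) 2 i).continuous
      exact this
    have hle : ∀ j i, g (φ j) i ≤ (lpAbs g' + ∑' j, lpAbs (g (φ j) - g') :
        lp (fun _ : ι => ℝ) 2) i := by
      intro j i
      have h1 := le_hasSum (hcoord i) j fun _ _ => abs_nonneg _
      simp only [lp.coeFn_add, Pi.add_apply, lpAbs_apply]
      have h2 := le_abs_self (g (φ j) i - g' i)
      have h3 := le_abs_self (g' i)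
      linarith
    have hadm := fun j => admissible_of_le hψ (hgA (φ j)) (hle j)
    refine ⟨(hadm 0).1, fun x hx => ?_⟩
    obtain ⟨j, hj⟩ := mem_iUnion.1 hx
    exact (hadm j).2 x (hA (hφj j) hj)
  · have h1 : ‖∑' j, lpAbs (g (φ j) - g')‖ ≤ ε * 2 :=
      tsum_of_norm_bounded hgeo fun j => by simpa using (hφ j).le
    calc _ ≤ ‖lpAbs g'‖ + ‖∑' j, lpAbs (g (φ j) - g')‖ := norm_add_le _ _
      _ ≤ c + ε * 2 := by rw [norm_lpAbs, hg'n]; gcongr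
      _ < c' := by rw [hε]; linarith

theorem CapGE.exists_of_iUnion (hψ : ∀ i x, 0 ≤ ψ i x) (A : ℕ → Set X) (hA : Monotone A)
    {c c' : ℝ} (hc : c' < c) (h : CapGE ψ (⋃ k, A k) c) : ∃ k, CapGE ψ (A k) c' := by
  by_contra! hcon
  have : ∀ k, ∃ f ∈ Admissible ψ (A k), ‖f‖ < c' := fun k => by
    have := hcon k
    simp only [CapGE] at this
    push Not at this
    exact this
  obtain ⟨f, hf, hfc⟩ := exists_admissible_iUnion hψ A hA hc this
  exact absurd (h f hf) (not_le.2 hfc)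

end Capacity

/-! ### Choquet capacitability: compact sets inside analytic sets. -/

section Capacitability

variable {X ι : Type*} {ψ : ι → X → ℝ}

theorem CapGE.mono {A B : Set X} (h : A ⊆ B) {c c' : ℝ} (hc : c' ≤ c) (hA : CapGE ψ A c) :
    CapGE ψ B c' := fun f hf => hc.trans (hA f (admissible_anti h hf))

/-- Sequences whose first `k` terms are bounded by those of `N`. -/
def boundedPrefix (N : ℕ → ℕ) (k : ℕ) : Set (ℕ → ℕ) := {x | ∀ i < k, x i ≤ N i}

/-- As the bound `m` on coordinate `k` grows, the new prefix sets increase to a set containing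
`boundedPrefix N k`, so continuity along increasing unions loses arbitrarily little capacity. -/
theorem exists_boundedPrefix_succ (hψ : ∀ i x, 0 ≤ ψ i x) (F : (ℕ → ℕ) → X) (N : ℕ → ℕ) (k : ℕ)
    {c c' : ℝ} (hc : c' < c) (h : CapGE ψ (F '' boundedPrefix N k) c) :
    ∃ m, CapGE ψ (F '' boundedPrefix (Function.update N k m) (k + 1)) c' := by
  refine CapGE.exists_of_iUnion hψ _ ?_ hc (h.mono ?_ le_rfl)
  · intro a b hab
    refine image_mono fun x hx i hi => (hx i hi).trans ?_
    by_cases hik : i = k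
    · subst hik; simpa using hab
    · simp [Function.update_of_ne hik]
  · rw [← image_iUnion]
    refine image_mono fun x hx => mem_iUnion.2 ⟨x k, fun i hi => ?_⟩
    by_cases hik : i = k
    · subst hik; simp
    · rw [Function.update_of_ne hik]
      exact hx i (by omega)

/-- The coordinates are bounded one at a time, and the total loss of capacity is kept below `c -
c'`. -/
theorem exists_forall_boundedPrefix (hψ : ∀ i x, 0 ≤ ψ i x) (F : (ℕ → ℕ) → X) {c c' : ℝ}
    (hc : c' < c) (h : CapGE ψ (range F) c) :
    ∃ N : ℕ → ℕ, ∀ k, CapGE ψ (F '' boundedPrefix N k) c' := by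
  -- Strictly decreasing thresholds from `c` down towards `c'`, so that each coordinate may use up a
  -- positive loss.
  set a : ℕ → ℝ := fun k => c' + (c - c') * (1 / 2) ^ k with ha
  have ha' : ∀ k, a (k + 1) < a k := fun k => by
    have h1 : 0 < c - c' := by linarith
    have h2 : (0 : ℝ) < (1 / 2) ^ k := by positivity
    simp only [ha, pow_succ]
    nlinarith [mul_pos h1 h2]
  have hac : ∀ k, c' ≤ a k := fun k => by
    have h1 : 0 < c - c' := by linarith
    have : (0 : ℝ) < (c - c') * (1 / 2) ^ k := by positivity
    simp only [ha]; linarith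
  have h0 : CapGE ψ (F '' boundedPrefix 0 0) (a 0) := by
    refine h.mono ?_ (by simp [ha])
    rintro _ ⟨x, rfl⟩
    exact ⟨x, fun i hi => absurd hi (by omega), rfl⟩
  choose next hnext using fun (k : ℕ) (N : ℕ → ℕ) (hN : CapGE ψ (F '' boundedPrefix N k) (a k)) =>
    exists_boundedPrefix_succ hψ F N k (ha' k) hN
  let S : ∀ k : ℕ, {N : ℕ → ℕ // CapGE ψ (F '' boundedPrefix N k) (a k)} := fun k =>
    Nat.rec ⟨0, h0⟩ (fun k N => ⟨Function.update N.1 k (next k N.1 N.2), hnext k N.1 N.2⟩) k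
  have hS : ∀ k, (S (k + 1)).1 = Function.update (S k).1 k (next k (S k).1 (S k).2) := fun k => rfl
  have hstab : ∀ i k, i + 1 ≤ k → (S k).1 i = (S (i + 1)).1 i := by
    intro i k hk
    induction k, hk using Nat.le_induction with
    | base => rfl
    | succ k hk ih => rw [hS, Function.update_of_ne (by omega), ih]
  -- Stage `k` alters only coordinate `k`, so coordinate `i` is final from stage `i + 1` on and the
  -- diagonal sequence agrees with stage `k` on its first `k` terms.
  refine ⟨fun i => (S (i + 1)).1 i, fun k => (S k).2.mono (image_mono fun x hx i hi => ?_) (hac k)⟩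
  exact (hx i hi).trans (hstab i k hi).le

theorem isCompact_setOf_forall_le (N : ℕ → ℕ) : IsCompact {x : ℕ → ℕ | ∀ i, x i ≤ N i} := by
  have : {x : ℕ → ℕ | ∀ i, x i ≤ N i} = Set.pi univ fun i => Set.Iic (N i) := by
    ext x; simp only [Set.mem_pi, mem_univ, true_imp_iff, mem_Iic]; rfl
  rw [this]
  exact isCompact_univ_pi fun i => (Set.finite_Iic (N i)).isCompact

/-- A set of sequences with all terms bounded has a neighbourhood basis of prefix conditions. -/
theorem exists_boundedPrefix_subset (N : ℕ → ℕ) (V : Set (ℕ → ℕ)) (hV : IsOpen V)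
    (h : {x : ℕ → ℕ | ∀ i, x i ≤ N i} ⊆ V) : ∃ k, boundedPrefix N k ⊆ V := by
  have hK := isCompact_setOf_forall_le N
  by_contra! hcon
  have hx : ∀ k, ∃ x ∈ boundedPrefix N k, x ∉ V := fun k => not_subset.1 (hcon k)
  choose x hx hxV using hx
  -- Truncation by `N` puts the points in the compact set, and it does not change the first `k`
  -- terms of `x k`; hence the untruncated subsequence has the same limit.
  obtain ⟨y, hy, φ, hφ, hlim⟩ := hK.tendsto_subseq (x := fun k i => min (x k i) (N i))
    (fun k i => min_le_right _ _)
  have hlim' : Tendsto (fun j => x (φ j)) atTop (𝓝 y) := by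
    rw [tendsto_pi_nhds] at hlim ⊢
    intro i
    refine (hlim i).congr' ?_
    filter_upwards [eventually_gt_atTop i] with j hj
    exact min_eq_left (hx (φ j) i (hj.trans_le (hφ.id_le j)))
  obtain ⟨j, hj⟩ := (hlim'.eventually (hV.mem_nhds (h hy))).exists
  exact hxV _ hj

/-- **Capacitability of analytic sets**: inner regularity of the `ℓ²`-capacity. -/
theorem exists_isCompact_capGE [TopologicalSpace X] (hψ : ∀ i x, 0 ≤ ψ i x)
    (hcont : ∀ i, Continuous (ψ i)) {E : Set X} (hE : AnalyticSet E) {c c' : ℝ} (hc : c' < c)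
    (hc' : 0 < c') (h : CapGE ψ E c) : ∃ K ⊆ E, IsCompact K ∧ CapGE ψ K c' := by
  rw [AnalyticSet] at hE
  rcases hE with rfl | ⟨F, hF, rfl⟩
  · have := h 0 ⟨fun i => le_rfl, by simp⟩
    rw [norm_zero] at this
    linarith
  obtain ⟨N, hN⟩ := exists_forall_boundedPrefix hψ F hc h
  have hK := isCompact_setOf_forall_le N
  refine ⟨F '' {x | ∀ i, x i ≤ N i}, image_subset_range _ _, hK.image hF, fun f hf => ?_⟩
  by_contra! hlt
  -- Inflating `f` by `r > 1` makes its potential strictly larger than one on the compact image.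
  -- Potentials are lower semicontinuous, so `r • f` remains admissible on a whole prefix
  -- neighbourhood, whose capacity is already known.
  obtain ⟨r, hr1, hr⟩ : ∃ r : ℝ, 1 < r ∧ r * ‖f‖ < c' := by
    have : Tendsto (fun r : ℝ => r * ‖f‖) (𝓝[>] 1) (𝓝 (1 * ‖f‖)) :=
      ((continuous_id.mul continuous_const).tendsto 1).mono_left nhdsWithin_le_nhds
    rw [one_mul] at this
    obtain ⟨r, h1, h2⟩ := ((this.eventually_lt_const hlt).and self_mem_nhdsWithin).exists
    exact ⟨r, h2, h1⟩
  have hr0 : 0 < r := by linarith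
  have hmul : ∀ x, ∑' i, ENNReal.ofReal ((r • f) i * ψ i x) =
      ENNReal.ofReal r * ∑' i, ENNReal.ofReal (f i * ψ i x) := fun x => by
    rw [← ENNReal.tsum_mul_left]
    refine tsum_congr fun i => ?_
    rw [← ENNReal.ofReal_mul hr0.le, lp.coeFn_smul, Pi.smul_apply, smul_eq_mul, mul_assoc]
  have hopen : IsOpen {x : X | 1 < ∑' i, ENNReal.ofReal ((r • f) i * ψ i x)} :=
    (lowerSemicontinuous_tsum fun i => (ENNReal.continuous_ofReal.comp
      (continuous_const.mul (hcont i))).lowerSemicontinuous).isOpen_preimage 1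
  obtain ⟨k, hk⟩ := exists_boundedPrefix_subset N _ (hopen.preimage hF) (fun x hx => by
    rw [mem_preimage, mem_ofPred_eq, hmul]
    calc (1 : ℝ≥0∞) < ENNReal.ofReal r := by simpa using hr1
      _ = ENNReal.ofReal r * 1 := by rw [mul_one]
      _ ≤ _ := by gcongr; exact hf.2 _ ⟨x, hx, rfl⟩)
  have hadm : r • f ∈ Admissible ψ (F '' boundedPrefix N k) := by
    refine ⟨fun i => ?_, ?_⟩
    · rw [lp.coeFn_smul, Pi.smul_apply, smul_eq_mul]
      exact mul_nonneg hr0.le (hf.1 i)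
    · rintro _ ⟨x, hx, rfl⟩
      exact le_of_lt (hk hx)
  have := hN k _ hadm
  rw [norm_smul, Real.norm_of_nonneg hr0.le] at this
  linarith

end Capacitability

/-! ### From positive capacity to measures of finite energy. -/

section Duality

open scoped Pointwise

variable {X ι : Type*} {ψ : ι → X → ℝ}

/-- A positive functional on `C(X)`, `X` compact, is integration against a finite measure. -/
theorem exists_measure_integral_eq [TopologicalSpace X] [CompactSpace X] [T2Space X]
    [MeasurableSpace X] [BorelSpace X] (L : C(X, ℝ) →ₗ[ℝ] ℝ)
    (hL : ∀ φ : C(X, ℝ), 0 ≤ φ → 0 ≤ L φ) :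
    ∃ μ : Measure X, IsFiniteMeasure μ ∧ ∀ φ : C(X, ℝ), ∫ x, φ x ∂μ = L φ := by
  let T : CompactlySupportedContinuousMap X ℝ →ₗ[ℝ] ℝ :=
    { toFun := fun f => L f.toContinuousMap
      map_add' := fun f g => by
        rw [← map_add]; rfl
      map_smul' := fun a f => by
        rw [RingHom.id_apply, ← map_smul]; rfl }
  let Λ := PositiveLinearMap.mk₀ T (fun f hf => hL f.toContinuousMap fun x => CompactlySupportedContinuousMap.le_def.1 hf x)
  refine ⟨RealRMK.rieszMeasure Λ, inferInstance, fun φ => ?_⟩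
  exact RealRMK.integral_rieszMeasure Λ (CompactlySupportedContinuousMap.continuousMapEquiv φ)

/-- Finitely supported nonnegative coefficients in the unit ball of `ℓ²`. -/
def unitCoeffs (ι : Type*) : Set (ι →₀ ℝ) :=
  {f | (∀ i, 0 ≤ f i) ∧ ∀ s : Finset ι, ∑ i ∈ s, f i ^ 2 ≤ 1}

theorem convex_unitCoeffs : Convex ℝ (unitCoeffs ι) := by
  rintro f ⟨hf, hf'⟩ g ⟨hg, hg'⟩ a b ha hb hab
  refine ⟨fun i => ?_, fun s => ?_⟩
  · simp only [Finsupp.add_apply, Finsupp.smul_apply, smul_eq_mul]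
    exact add_nonneg (mul_nonneg ha (hf i)) (mul_nonneg hb (hg i))
  · calc ∑ i ∈ s, (a • f + b • g) i ^ 2 ≤ ∑ i ∈ s, (a * f i ^ 2 + b * g i ^ 2) := by
          refine Finset.sum_le_sum fun i _ => ?_
          simp only [Finsupp.add_apply, Finsupp.smul_apply, smul_eq_mul]
          obtain rfl : b = 1 - a := by linarith
          nlinarith [mul_nonneg (mul_nonneg ha hb) (sq_nonneg (f i - g i))]
      _ = a * ∑ i ∈ s, f i ^ 2 + b * ∑ i ∈ s, g i ^ 2 := by
          rw [Finset.sum_add_distrib, Finset.mul_sum, Finset.mul_sum]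
      _ ≤ a * 1 + b * 1 := by gcongr; exacts [hf' s, hg' s]
      _ = 1 := by linarith

/-- If the potential of `f` were at least `M` throughout `K`, then `f / M` would be admissible with
norm at most `1 / M < c`. -/
theorem CapGE.linearCombination_le {K : Set X} {c : ℝ} (hc : 0 < c) (h : CapGE ψ K c)
    (hψ : ∀ i x, 0 ≤ ψ i x) {f : ι →₀ ℝ} (hf : f ∈ unitCoeffs ι) {M : ℝ} (hM : c⁻¹ < M) :
    ∃ x ∈ K, f.sum (fun i a => a * ψ i x) < M := by
  by_contra! hcon
  have hM0 : 0 < M := (inv_pos.2 hc).trans hM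
  have hmem : Memℓp (fun i => M⁻¹ * f i) 2 := by
    refine (memℓp_gen_iff (by norm_num)).2 (summable_of_ne_finset_zero (s := f.support) ?_)
    intro i hi
    simp [Finsupp.notMem_support_iff.1 hi]
  let g : lp (fun _ : ι => ℝ) 2 := ⟨fun i => M⁻¹ * f i, hmem⟩
  have hg : g ∈ Admissible ψ K := by
    refine ⟨fun i => mul_nonneg (inv_nonneg.2 hM0.le) (hf.1 i), fun x hx => ?_⟩
    calc (1 : ℝ≥0∞) ≤ ENNReal.ofReal (M⁻¹ * f.sum (fun i a => a * ψ i x)) := by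
          rw [ENNReal.one_le_ofReal, ← div_eq_inv_mul, one_le_div hM0]
          exact hcon x hx
      _ = ∑ i ∈ f.support, ENNReal.ofReal (g i * ψ i x) := by
          rw [Finsupp.sum, Finset.mul_sum, ENNReal.ofReal_sum_of_nonneg]
          · refine Finset.sum_congr rfl fun i _ => ?_
            rw [← mul_assoc]
          · intro i _
            exact mul_nonneg (inv_nonneg.2 hM0.le) (mul_nonneg (hf.1 i) (hψ i x))
      _ ≤ _ := ENNReal.sum_le_tsum _
  have h1 := h g hg
  have h2 : ‖g‖ ^ 2 ≤ (M⁻¹) ^ 2 := by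
    have := lp.norm_rpow_eq_tsum (p := 2) (by norm_num) g
    simp only [ENNReal.toReal_ofNat, Real.rpow_ofNat] at this
    rw [this, tsum_eq_sum (s := f.support)]
    · calc ∑ i ∈ f.support, ‖g i‖ ^ 2 = (M⁻¹) ^ 2 * ∑ i ∈ f.support, f i ^ 2 := by
            rw [Finset.mul_sum]
            refine Finset.sum_congr rfl fun i _ => ?_
            rw [Real.norm_eq_abs, sq_abs, ← mul_pow]
        _ ≤ (M⁻¹) ^ 2 * 1 := by gcongr; exact hf.2 _
        _ = _ := mul_one _
    · intro i hi
      have : g i = M⁻¹ * f i := rfl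
      simp [this, Finsupp.notMem_support_iff.1 hi]
  have h3 : ‖g‖ ≤ M⁻¹ := le_of_sq_le_sq h2 (inv_nonneg.2 hM0.le)
  have h4 : M⁻¹ < c := by
    rw [inv_lt_comm₀ hM0 hc]; exact hM
  linarith

/-- A compact set of positive capacity carries a nonzero measure of finite energy. -/
theorem exists_measure_of_capGE [TopologicalSpace X] [T2Space X] [MeasurableSpace X] [BorelSpace X]
    (hψ : ∀ i x, 0 ≤ ψ i x) (hcont : ∀ i, Continuous (ψ i)) {K : Set X} (hK : IsCompact K)
    {c : ℝ} (hc : 0 < c) (h : CapGE ψ K c) :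
    ∃ μ : Measure X, IsFiniteMeasure μ ∧ μ univ ≠ 0 ∧ μ Kᶜ = 0 ∧
      ∃ D : ℝ, ∀ s : Finset ι, ∑ i ∈ s, (∫ x, ψ i x ∂μ) ^ 2 ≤ D := by
  have : CompactSpace K := isCompact_iff_compactSpace.1 hK
  let ψK : ι → C(K, ℝ) := fun i => ⟨fun x => ψ i x, (hcont i).comp continuous_subtype_val⟩
  let Ψ : (ι →₀ ℝ) →ₗ[ℝ] C(K, ℝ) := Finsupp.linearCombination ℝ ψK
  have hΨ : ∀ f x, Ψ f x = f.sum (fun i a => a * ψ i x) := fun f x => by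
    simp only [Ψ, Finsupp.linearCombination_apply, Finsupp.sum]
    rw [ContinuousMap.sum_apply]
    rfl
  let Neg : Set C(K, ℝ) := {φ | ∀ x, φ x < 0}
  have hNopen : IsOpen Neg := by
    have := ContinuousMap.isOpen_setOfPred_mapsTo (X := K) (Y := ℝ) isCompact_univ (isOpen_Iio (a := 0))
    convert this using 1
    ext φ
    simp [Neg, MapsTo]
  have hNconv : Convex ℝ Neg := by
    intro φ hφ χ hχ a b ha hb hab x
    simp only [ContinuousMap.add_apply, ContinuousMap.smul_apply, smul_eq_mul]
    have h1 := hφ x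
    have h2 := hχ x
    rcases ha.eq_or_lt with rfl | ha
    · have : b = 1 := by linarith
      subst this; simpa using h2
    · nlinarith [mul_pos_of_neg_of_neg (neg_neg_of_pos ha) h1, mul_nonneg hb (neg_nonneg.2 h2.le)]
  -- The functions lying strictly below some potential from the unit ball. The constant `M` is not
  -- among them, so Hahn–Banach separates it from this open convex set.
  let U : Set C(K, ℝ) := Ψ '' unitCoeffs ι + Neg
  have hUopen : IsOpen U := hNopen.add_left
  have hUconv : Convex ℝ U := (convex_unitCoeffs.linear_image Ψ).add hNconv
  let one : C(K, ℝ) := ContinuousMap.const K 1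
  obtain ⟨M, hM⟩ := exists_gt c⁻¹
  have hM0 : 0 < M := (inv_pos.2 hc).trans hM
  have hMU : M • one ∉ U := by
    rintro ⟨_, ⟨f, hf, rfl⟩, φ, hφ, hsum⟩
    obtain ⟨x, hx, hlt⟩ := h.linearCombination_le hc hψ hf hM
    have h1 := congrArg (fun χ : C(K, ℝ) => χ ⟨x, hx⟩) hsum
    have h2 := hφ ⟨x, hx⟩
    have h3 := hΨ f ⟨x, hx⟩
    simp only [ContinuousMap.add_apply, ContinuousMap.smul_apply, smul_eq_mul, one,
      ContinuousMap.const_apply, mul_one] at h1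
    simp only at h3
    linarith
  obtain ⟨L, hL⟩ := geometric_hahn_banach_open_point hUconv hUopen hMU
  have h0 : (0 : ι →₀ ℝ) ∈ unitCoeffs ι := ⟨fun i => le_rfl, fun s => by simp⟩
  have hNU : ∀ φ ∈ Neg, φ ∈ U := fun φ hφ => ⟨0, ⟨0, h0, map_zero Ψ⟩, φ, hφ, zero_add φ⟩
  have hpos : ∀ φ : C(K, ℝ), 0 ≤ φ → 0 ≤ L φ := by
    intro φ hφ
    by_contra! hneg
    -- `U` contains all negative functions, hence `-tφ - 1` for every `t ≥ 0`; boundedness of `L`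
    -- above on `U` forces `L φ ≥ 0`.
    have h1 : ∀ t : ℝ, 0 ≤ t → t * (-L φ) < L (M • one) + L one := by
      intro t ht
      have := hL (-(t • φ) - one) (hNU _ fun x => ?_)
      · rw [map_sub, map_neg, map_smul, smul_eq_mul] at this
        linarith
      · have : 0 ≤ t * φ x := mul_nonneg ht (hφ x)
        simp only [ContinuousMap.sub_apply, ContinuousMap.neg_apply, ContinuousMap.smul_apply,
          smul_eq_mul, one, ContinuousMap.const_apply]
        linarith
    have h2 := h1 (|L (M • one) + L one| / (-L φ)) (by
      exact div_nonneg (abs_nonneg _) (by linarith))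
    rw [div_mul_cancel₀ _ (by linarith)] at h2
    exact absurd (le_abs_self _) (not_le.2 h2)
  have hone : 0 < L one := by
    have := hL (-one) (hNU _ fun x => by simp [one])
    rw [map_neg, map_smul, smul_eq_mul] at this
    nlinarith
  obtain ⟨μ, hμ, hint⟩ := exists_measure_integral_eq (L : C(K, ℝ) →ₗ[ℝ] ℝ) hpos
  have hμ1 : μ univ ≠ 0 := by
    intro hzero
    have h1 := hint one
    rw [Measure.measure_univ_eq_zero.1 hzero] at h1
    simp only [integral_zero_measure] at h1
    exact hone.ne h1
  have hmeas : Measurable (Subtype.val : K → X) := measurable_subtype_coe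
  refine ⟨μ.map Subtype.val, inferInstance, ?_, ?_, ?_⟩
  · rwa [Measure.map_apply hmeas MeasurableSet.univ, preimage_univ]
  · rw [Measure.map_apply hmeas hK.measurableSet.compl]
    have : (Subtype.val : K → X) ⁻¹' Kᶜ = ∅ := by ext x; simp
    rw [this, measure_empty]
  set B := L (M • one) + L one with hB
  have hInt : ∀ i, ∫ x, ψ i x ∂(μ.map Subtype.val) = L (ψK i) := fun i => by
    rw [integral_map hmeas.aemeasurable (hcont i).aestronglyMeasurable]
    exact hint (ψK i)
  have hbound : ∀ f ∈ unitCoeffs ι, L (Ψ f) ≤ B := by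
    intro f hf
    have := hL (Ψ f + -one) ⟨Ψ f, ⟨f, hf, rfl⟩, -one, fun x => by simp [one], rfl⟩
    rw [map_add, map_neg] at this
    linarith
  refine ⟨B ^ 2, fun s => ?_⟩
  simp_rw [hInt]
  have ha : ∀ i, 0 ≤ L (ψK i) := fun i => hpos _ fun x => hψ i x
  set Q := ∑ i ∈ s, L (ψK i) ^ 2 with hQ
  have hQ0 : 0 ≤ Q := Finset.sum_nonneg fun i _ => sq_nonneg _
  rcases hQ0.eq_or_lt with hQ0 | hQ0
  · rw [← hQ0]; positivity
  classical
  have hs : 0 < Real.sqrt Q := Real.sqrt_pos.2 hQ0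
  -- The extremal vector in Cauchy–Schwarz: pairing with it recovers the `ℓ²`-norm of the integrals
  -- over `s`.
  let f : ι →₀ ℝ := Finsupp.onFinset s (fun i => if i ∈ s then L (ψK i) / Real.sqrt Q else 0)
    (fun i hi => by by_contra hc; simp [hc] at hi)
  have hf : f ∈ unitCoeffs ι := by
    refine ⟨fun i => ?_, fun t => ?_⟩
    · simp only [f, Finsupp.onFinset_apply]
      split_ifs
      · exact div_nonneg (ha i) hs.le
      · exact le_rfl
    · calc ∑ i ∈ t, f i ^ 2 ≤ ∑ i ∈ t ∪ s, f i ^ 2 :=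
            Finset.sum_le_sum_of_subset_of_nonneg Finset.subset_union_left
              fun i _ _ => sq_nonneg _
        _ = ∑ i ∈ s, f i ^ 2 := by
            refine (Finset.sum_subset Finset.subset_union_right fun i _ hi => ?_).symm
            simp [f, hi]
        _ = ∑ i ∈ s, L (ψK i) ^ 2 / Q := by
            refine Finset.sum_congr rfl fun i hi => ?_
            simp [f, hi, div_pow, Real.sq_sqrt hQ0.le]
        _ = 1 := by rw [← Finset.sum_div, div_self hQ0.ne']
        _ ≤ 1 := le_rfl
  have hLf : L (Ψ f) = Real.sqrt Q := by
    have : Ψ f = ∑ i ∈ s, (L (ψK i) / Real.sqrt Q) • ψK i := by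
      simp only [Ψ, Finsupp.linearCombination_apply]
      rw [Finsupp.sum_of_support_subset (s := s) f Finsupp.support_onFinset_subset
        (fun i a => a • ψK i) (fun i _ => zero_smul _ _)]
      exact Finset.sum_congr rfl fun i hi => by simp [f, hi]
    rw [this, map_sum]
    simp_rw [map_smul, smul_eq_mul]
    calc ∑ i ∈ s, L (ψK i) / Real.sqrt Q * L (ψK i) = Q / Real.sqrt Q := by
          rw [hQ, Finset.sum_div]
          exact Finset.sum_congr rfl fun i _ => by ring
      _ = Real.sqrt Q := Real.div_sqrt
  have := hbound f hf
  rw [hLf] at this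
  calc Q = Real.sqrt Q ^ 2 := (Real.sq_sqrt hQ0.le).symm
    _ ≤ B ^ 2 := by gcongr

end Duality

/-! ### Dyadic bumps and Frostman's lemma. -/

section Lattice

open scoped NNReal

variable {n : ℕ}

/-- The vector with the given integer coordinates. -/
def latticePoint (j : Fin n → ℤ) : Fin n → ℝ := fun i => (j i : ℝ)

/-- A bump of width comparable to `2⁻ᵏ` around the dyadic lattice point `2⁻ᵏ j`. -/
def bump (i : ℕ × (Fin n → ℤ)) (x : EuclideanSpace ℝ (Fin n)) : ℝ :=
  max 0 (3 - ‖(2 : ℝ) ^ i.1 • x.ofLp - latticePoint i.2‖)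

/-- The cube of side comparable to `2⁻ᵏ` that supports the bump. -/
def bumpCube (i : ℕ × (Fin n → ℤ)) : Set (EuclideanSpace ℝ (Fin n)) :=
  {x | ‖(2 : ℝ) ^ i.1 • x.ofLp - latticePoint i.2‖ < 3}

theorem bump_nonneg (i : ℕ × (Fin n → ℤ)) (x : EuclideanSpace ℝ (Fin n)) : 0 ≤ bump i x :=
  le_max_left _ _

theorem bump_le (i : ℕ × (Fin n → ℤ)) (x : EuclideanSpace ℝ (Fin n)) : bump i x ≤ 3 :=
  max_le (by norm_num) (by linarith [norm_nonneg ((2 : ℝ) ^ i.1 • x.ofLp - latticePoint i.2)])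

theorem continuous_bump (i : ℕ × (Fin n → ℤ)) : Continuous (bump i) := by
  unfold bump
  fun_prop

theorem bump_eq_zero {i : ℕ × (Fin n → ℤ)} {x : EuclideanSpace ℝ (Fin n)} (h : x ∉ bumpCube i) :
    bump i x = 0 := by
  have : (3 : ℝ) ≤ ‖(2 : ℝ) ^ i.1 • x.ofLp - latticePoint i.2‖ := not_lt.1 h
  exact max_eq_left (by linarith)

/-- Bounded overlap: in each coordinate at most seven integers are within distance 3 of a given
real, and each bump is at most 3. -/
theorem tsum_bump_le (k : ℕ) (x : EuclideanSpace ℝ (Fin n)) :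
    ∑' j : Fin n → ℤ, ENNReal.ofReal (bump (k, j) x) ≤ ENNReal.ofReal (3 * 7 ^ n) := by
  classical
  set y : Fin n → ℝ := (2 : ℝ) ^ k • x.ofLp with hy
  let S : Finset (Fin n → ℤ) :=
    Fintype.piFinset fun i => Finset.Icc (⌊y i⌋ - 3) (⌊y i⌋ + 3)
  have hS : S.card = 7 ^ n := by
    simp only [S, Fintype.card_piFinset, Int.card_Icc]
    rw [Finset.prod_congr rfl (g := fun _ => 7)]
    · simp
    · intro i _
      omega
  have hzero : ∀ j ∉ S, ENNReal.ofReal (bump (k, j) x) = 0 := by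
    intro j hj
    rw [bump_eq_zero, ENNReal.ofReal_zero]
    intro hmem
    apply hj
    refine Fintype.mem_piFinset.2 fun i => Finset.mem_Icc.2 ?_
    have h1 : |y i - j i| < 3 :=
      lt_of_le_of_lt (norm_le_pi_norm (y - latticePoint j) i) hmem
    have h2 := Int.floor_le (y i)
    have h3 := Int.lt_floor_add_one (y i)
    rw [abs_lt] at h1
    have h4 : ((⌊y i⌋ - 3 : ℤ) : ℝ) < j i := by push_cast; linarith
    have h5 : (j i : ℝ) < ((⌊y i⌋ + 4 : ℤ) : ℝ) := by push_cast; linarith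
    have h4' := Int.cast_lt.1 h4
    have h5' := Int.cast_lt.1 h5
    omega
  rw [tsum_eq_sum hzero]
  calc ∑ j ∈ S, ENNReal.ofReal (bump (k, j) x) ≤ ∑ j ∈ S, ENNReal.ofReal 3 :=
        Finset.sum_le_sum fun j _ => ENNReal.ofReal_le_ofReal (bump_le _ _)
    _ = ENNReal.ofReal (3 * 7 ^ n) := by
        rw [Finset.sum_const, hS, nsmul_eq_mul, mul_comm, ENNReal.ofReal_mul (by norm_num)]
        congr 1
        rw [ENNReal.ofReal_pow (by norm_num)]
        simp

/-- The factor 6 is twice the sup-norm radius; `√n` compares the Euclidean norm with the sup norm.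
-/
theorem ediam_bumpCube_le (i : ℕ × (Fin n → ℤ)) :
    Metric.ediam (bumpCube i) ≤ ENNReal.ofReal (6 * (n : ℝ) ^ (1 / 2 : ℝ) * (1 / 2) ^ i.1) := by
  refine Metric.ediam_le fun x hx y hy => ?_
  have h1 := (PiLp.antilipschitzWith_ofLp 2 (fun _ : Fin n => ℝ)).le_mul_dist x y
  rw [edist_dist]
  refine ENNReal.ofReal_le_ofReal (h1.trans ?_)
  have h2 : dist x.ofLp y.ofLp ≤ 6 * (1 / 2) ^ i.1 := by
    have h3 : ‖(2 : ℝ) ^ i.1 • x.ofLp - (2 : ℝ) ^ i.1 • y.ofLp‖ ≤ 6 := by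
      have hx' : ‖(2 : ℝ) ^ i.1 • x.ofLp - latticePoint i.2‖ < 3 := hx
      have hy' : ‖(2 : ℝ) ^ i.1 • y.ofLp - latticePoint i.2‖ < 3 := hy
      have := norm_sub_le ((2 : ℝ) ^ i.1 • x.ofLp - latticePoint i.2)
        ((2 : ℝ) ^ i.1 • y.ofLp - latticePoint i.2)
      rw [sub_sub_sub_cancel_right] at this
      linarith
    rw [← smul_sub, norm_smul, Real.norm_of_nonneg (by positivity)] at h3
    rw [dist_eq_norm, one_div, inv_pow, ← div_eq_mul_inv, le_div_iff₀ (by positivity)]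
    linarith
  calc _ ≤ ((n : ℝ) ^ (1 / 2 : ℝ)) * (6 * (1 / 2) ^ i.1) := by
        have hc : (((Fintype.card (Fin n) : ℝ≥0) ^ (1 / (2 : ℝ≥0∞)).toReal : ℝ≥0) : ℝ) =
            (n : ℝ) ^ (1 / 2 : ℝ) := by
          simp
        rw [hc]
        gcongr
    _ = _ := by ring

/-- The bumps of generation `k`, scaled by `qᵏ`. -/
def scaledBump (q : ℝ) (i : ℕ × (Fin n → ℤ)) (x : EuclideanSpace ℝ (Fin n)) : ℝ :=
  q ^ i.1 * bump i x

theorem scaledBump_nonneg {q : ℝ} (hq : 0 ≤ q) (i : ℕ × (Fin n → ℤ))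
    (x : EuclideanSpace ℝ (Fin n)) : 0 ≤ scaledBump q i x :=
  mul_nonneg (pow_nonneg hq _) (bump_nonneg _ _)

theorem continuous_scaledBump (q : ℝ) (i : ℕ × (Fin n → ℤ)) : Continuous (scaledBump q i) :=
  continuous_const.mul (continuous_bump i)

/-- An admissible function has large coefficients on cubes that cover the set. -/
theorem exists_mem_bumpCube_of_admissible {q ρ B : ℝ} (hρ : 0 < ρ) (hρ1 : ρ < 1)
    (hB : 0 < B) (hB' : B * (1 - ρ)⁻¹ * (3 * 7 ^ n) < 1) {E : Set (EuclideanSpace ℝ (Fin n))}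
    {f : lp (fun _ : ℕ × (Fin n → ℤ) => ℝ) 2} (hf : f ∈ Admissible (scaledBump q) E)
    {x : EuclideanSpace ℝ (Fin n)} (hx : x ∈ E) :
    ∃ i, x ∈ bumpCube i ∧ B * ρ ^ i.1 ≤ f i * q ^ i.1 := by
  -- Otherwise the potential at `x` would be at most the geometric sum of `B ρ^k` times the overlap
  -- constant, which is less than one.
  by_contra! hcon
  have hle : ∀ i : ℕ × (Fin n → ℤ), ENNReal.ofReal (f i * scaledBump q i x) ≤
      ENNReal.ofReal (B * ρ ^ i.1) * ENNReal.ofReal (bump i x) := by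
    intro i
    rw [← ENNReal.ofReal_mul (by positivity)]
    refine ENNReal.ofReal_le_ofReal ?_
    by_cases hi : x ∈ bumpCube i
    · rw [scaledBump, ← mul_assoc]
      exact mul_le_mul_of_nonneg_right (hcon i hi).le (bump_nonneg _ _)
    · simp [scaledBump, bump_eq_zero hi]
  have hgeo : ∑' k : ℕ, ENNReal.ofReal (B * ρ ^ k) = ENNReal.ofReal (B * (1 - ρ)⁻¹) := by
    rw [← ENNReal.ofReal_tsum_of_nonneg (fun k => by positivity)
      ((summable_geometric_of_lt_one hρ.le hρ1).mul_left B), tsum_mul_left,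
      tsum_geometric_of_lt_one hρ.le hρ1]
  have : (1 : ℝ≥0∞) ≤ ENNReal.ofReal (B * (1 - ρ)⁻¹ * (3 * 7 ^ n)) :=
    calc (1 : ℝ≥0∞) ≤ ∑' i, ENNReal.ofReal (f i * scaledBump q i x) := hf.2 x hx
      _ ≤ ∑' i : ℕ × (Fin n → ℤ), ENNReal.ofReal (B * ρ ^ i.1) * ENNReal.ofReal (bump i x) :=
          ENNReal.tsum_le_tsum hle
      _ = ∑' k : ℕ, ENNReal.ofReal (B * ρ ^ k) *
            ∑' j : Fin n → ℤ, ENNReal.ofReal (bump (k, j) x) := by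
          rw [ENNReal.tsum_prod']
          simp_rw [ENNReal.tsum_mul_left]
      _ ≤ ∑' k : ℕ, ENNReal.ofReal (B * ρ ^ k) * ENNReal.ofReal (3 * 7 ^ n) :=
          ENNReal.tsum_le_tsum fun k => by gcongr; exact tsum_bump_le k x
      _ = _ := by
          rw [ENNReal.tsum_mul_right, hgeo, ← ENNReal.ofReal_mul]
          have : 0 < 1 - ρ := by linarith
          positivity
  rw [ENNReal.one_le_ofReal] at this
  linarith

/-- A set of positive `t`-dimensional Hausdorff measure has positive capacity of every smaller
order `s`. -/
theorem exists_capGE_of_hausdorffMeasure_ne_zero {s t : ℝ} (hst : s < t) (ht : 0 < t)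
    {E : Set (EuclideanSpace ℝ (Fin n))} (hE : μH[t] E ≠ 0) :
    ∃ c, 0 < c ∧ CapGE (scaledBump ((2 : ℝ) ^ (s / 2))) E c := by
  set q : ℝ := (2 : ℝ) ^ (s / 2) with hq
  -- Chosen so that `(ρ / q)² = 2^(-t)`: a coefficient of size at least `B (ρ / q)^k` has square at
  -- least `B² 2^(-kt)`, which pays for the `t`-th power of the diameter of a generation-`k` cube.
  -- It is less than one because `s < t`.
  set ρ : ℝ := (2 : ℝ) ^ ((s - t) / 2) with hρ
  have hq0 : 0 < q := by positivity
  have hρ0 : 0 < ρ := by positivity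
  have hρ1 : ρ < 1 := Real.rpow_lt_one_of_one_lt_of_neg (by norm_num) (by linarith)
  have h1ρ : 0 < 1 - ρ := by linarith
  set B : ℝ := (1 - ρ) / (2 * (3 * 7 ^ n)) with hBdef
  have hB : 0 < B := by positivity
  have hB' : B * (1 - ρ)⁻¹ * (3 * 7 ^ n) < 1 := by
    have : B * (1 - ρ)⁻¹ * (3 * 7 ^ n) = 1 / 2 := by
      rw [hBdef]; field_simp
    rw [this]; norm_num
  by_contra! hcon
  have hex : ∀ m : ℕ, ∃ f ∈ Admissible (scaledBump (n := n) q) E, ‖f‖ < 1 / ((m : ℝ) + 1) := by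
    intro m
    have := hcon _ (Nat.one_div_pos_of_nat (n := m))
    simp only [CapGE] at this
    push Not at this
    exact this
  choose f hf hfm using hex
  have hkey : ∀ (m : ℕ) (i : ℕ × (Fin n → ℤ)), B * ρ ^ i.1 ≤ f m i * q ^ i.1 →
      ((1 / 2 : ℝ) ^ i.1) ^ t ≤ f m i ^ 2 / B ^ 2 := by
    intro m i hi
    have h1 : (B * ρ ^ i.1) ^ 2 ≤ (f m i * q ^ i.1) ^ 2 := by gcongr
    have h2 : (ρ ^ i.1) ^ 2 = ((1 / 2 : ℝ) ^ i.1) ^ t * (q ^ i.1) ^ 2 := by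
      have e1 : (1 / 2 : ℝ) = (2 : ℝ) ^ (-1 : ℝ) := by rw [Real.rpow_neg_one]; norm_num
      rw [hρ, hq, e1]
      simp only [← Real.rpow_natCast, ← Real.rpow_mul (show (0 : ℝ) ≤ 2 by norm_num)]
      rw [← Real.rpow_add (by norm_num)]
      congr 1
      push_cast
      ring
    rw [le_div_iff₀ (by positivity)]
    rw [mul_pow, mul_pow, h2] at h1
    have h3 : 0 < (q ^ i.1) ^ 2 := by positivity
    exact le_of_mul_le_mul_right (by linarith) h3
  set A : ℝ := 6 * (n : ℝ) ^ (1 / 2 : ℝ) with hA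
  have hA0 : 0 ≤ A := by positivity
  classical
  -- The cubes with large coefficients cover `E`, and their total `diam^t` is `≲ ‖f m‖²`, which
  -- tends to zero.
  let T : ℕ → ℕ × (Fin n → ℤ) → Set (EuclideanSpace ℝ (Fin n)) := fun m i =>
    if B * ρ ^ i.1 ≤ f m i * q ^ i.1 then bumpCube i else ∅
  have hsq : ∀ m, HasSum (fun i => f m i ^ 2) (‖f m‖ ^ 2) := fun m => by
    have := lp.hasSum_norm (p := 2) (by norm_num) (f m)
    simpa using this
  have hTdiam : ∀ m i, Metric.ediam (T m i) ^ t ≤ ENNReal.ofReal (A ^ t / B ^ 2 * f m i ^ 2) := by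
    intro m i
    by_cases hi : B * ρ ^ i.1 ≤ f m i * q ^ i.1
    · simp only [T, if_pos hi]
      calc _ ≤ ENNReal.ofReal (A * (1 / 2) ^ i.1) ^ t := by gcongr; exact ediam_bumpCube_le i
        _ = ENNReal.ofReal (A ^ t * ((1 / 2) ^ i.1) ^ t) := by
            rw [ENNReal.ofReal_rpow_of_nonneg (by positivity) ht.le,
              Real.mul_rpow hA0 (by positivity)]
        _ ≤ ENNReal.ofReal (A ^ t * (f m i ^ 2 / B ^ 2)) := by gcongr; exact hkey m i hi
        _ = _ := by congr 1; ring
    · simp [T, if_neg hi, ht]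
  have hsumle : ∀ m, ∑' i, Metric.ediam (T m i) ^ t ≤
      ENNReal.ofReal (A ^ t / B ^ 2 * (1 / ((m : ℝ) + 1)) ^ 2) := by
    intro m
    calc _ ≤ ∑' i, ENNReal.ofReal (A ^ t / B ^ 2 * f m i ^ 2) := ENNReal.tsum_le_tsum (hTdiam m)
      _ = ENNReal.ofReal (A ^ t / B ^ 2 * ‖f m‖ ^ 2) := by
          rw [← ENNReal.ofReal_tsum_of_nonneg (fun i => by positivity)
            ((hsq m).summable.mul_left _), tsum_mul_left, (hsq m).tsum_eq]
      _ ≤ _ := by gcongr; exact (hfm m).le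
  have hlim : Tendsto (fun m : ℕ => ENNReal.ofReal (A ^ t / B ^ 2 * (1 / ((m : ℝ) + 1)) ^ 2))
      atTop (𝓝 0) := by
    have := ((tendsto_one_div_add_atTop_nhds_zero_nat (𝕜 := ℝ)).pow 2).const_mul (A ^ t / B ^ 2)
    simpa using ENNReal.tendsto_ofReal this
  have hlim' : Tendsto (fun m : ℕ =>
      ENNReal.ofReal (A ^ t / B ^ 2 * (1 / ((m : ℝ) + 1)) ^ 2) ^ t⁻¹) atTop (𝓝 0) := by
    have := (ENNReal.continuous_rpow_const (y := t⁻¹)).tendsto 0 |>.comp hlim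
    simpa [ENNReal.zero_rpow_of_pos (inv_pos.2 ht), Function.comp_def] using this
  refine hE (le_antisymm ?_ (zero_le))
  calc μH[t] E ≤ liminf (fun m => ∑' i, Metric.ediam (T m i) ^ t) atTop := by
        refine Measure.hausdorffMeasure_le_liminf_tsum t E _ hlim' T
          (Eventually.of_forall fun m i => ?_) (Eventually.of_forall fun m x hx => ?_)
        · rw [ENNReal.le_rpow_inv_iff ht]
          exact (ENNReal.le_tsum i).trans (hsumle m)
        · obtain ⟨i, hxi, hi⟩ :=
            exists_mem_bumpCube_of_admissible hρ0 hρ1 hB hB' (hf m) hx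
          refine mem_iUnion.2 ⟨i, ?_⟩
          simpa only [T, if_pos hi] using hxi
    _ ≤ liminf (fun m : ℕ => ENNReal.ofReal (A ^ t / B ^ 2 * (1 / ((m : ℝ) + 1)) ^ 2)) atTop :=
        liminf_le_liminf (Eventually.of_forall hsumle)
    _ = 0 := hlim.liminf_eq

/-- Finite energy bounds the mass that the product measure gives to dyadic neighbourhoods of the
diagonal. -/
theorem prod_dist_le_of_energy {q : ℝ} (hq : 0 < q) (μ : Measure (EuclideanSpace ℝ (Fin n)))
    [IsFiniteMeasure μ] {D : ℝ}
    (hD : ∀ s : Finset (ℕ × (Fin n → ℤ)), ∑ i ∈ s, (∫ x, scaledBump q i x ∂μ) ^ 2 ≤ D) (k : ℕ) :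
    (μ.prod μ) {z | dist z.1 z.2 ≤ (1 / 2) ^ k} ≤ ENNReal.ofReal (D / (q ^ 2) ^ k) := by
  have hmeas : ∀ j : Fin n → ℤ, Measurable fun x => ENNReal.ofReal (bump (k, j) x) := fun j =>
    (continuous_bump _).measurable.ennreal_ofReal
  have hpoint : ∀ z : EuclideanSpace ℝ (Fin n) × EuclideanSpace ℝ (Fin n),
      {z : EuclideanSpace ℝ (Fin n) × EuclideanSpace ℝ (Fin n) |
        dist z.1 z.2 ≤ (1 / 2) ^ k}.indicator 1 z ≤
      ∑' j : Fin n → ℤ, ENNReal.ofReal (bump (k, j) z.1) * ENNReal.ofReal (bump (k, j) z.2) := by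
    rintro ⟨x, y⟩
    by_cases hxy : dist x y ≤ (1 / 2) ^ k
    · rw [indicator_of_mem (by exact hxy), Pi.one_apply]
      -- Rounding down puts `x` within 1 of the lattice point and `y` within 2, so a bump of height
      -- 3 is at least one at both.
      set j : Fin n → ℤ := fun i => ⌊(2 : ℝ) ^ k * x i⌋ with hj
      have hx : ‖(2 : ℝ) ^ k • x.ofLp - latticePoint j‖ ≤ 1 := by
        refine (pi_norm_le_iff_of_nonneg zero_le_one).2 fun i => ?_
        have h1 := Int.floor_le ((2 : ℝ) ^ k * x i)
        have h2 := Int.lt_floor_add_one ((2 : ℝ) ^ k * x i)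
        simp only [Pi.sub_apply, Pi.smul_apply, smul_eq_mul, latticePoint, hj, Real.norm_eq_abs]
        rw [abs_le]
        constructor <;> linarith
      have hdist : ‖(2 : ℝ) ^ k • y.ofLp - (2 : ℝ) ^ k • x.ofLp‖ ≤ 1 := by
        have h1 : ‖y.ofLp - x.ofLp‖ ≤ dist x y := by
          rw [dist_comm, dist_eq_norm]
          refine (pi_norm_le_iff_of_nonneg (norm_nonneg _)).2 fun i => ?_
          exact PiLp.norm_apply_le (y - x) i
        rw [← smul_sub, norm_smul, Real.norm_of_nonneg (by positivity)]
        calc (2 : ℝ) ^ k * ‖y.ofLp - x.ofLp‖ ≤ 2 ^ k * (1 / 2) ^ k := by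
              gcongr; exact h1.trans hxy
          _ = 1 := by rw [← mul_pow]; norm_num
      have hy : ‖(2 : ℝ) ^ k • y.ofLp - latticePoint j‖ ≤ 2 := by
        have := norm_add_le ((2 : ℝ) ^ k • y.ofLp - (2 : ℝ) ^ k • x.ofLp)
          ((2 : ℝ) ^ k • x.ofLp - latticePoint j)
        rw [sub_add_sub_cancel] at this
        linarith
      have hbx : (1 : ℝ≥0∞) ≤ ENNReal.ofReal (bump (k, j) x) :=
        ENNReal.one_le_ofReal.2 (le_max_of_le_right (by simp only; linarith))
      have hby : (1 : ℝ≥0∞) ≤ ENNReal.ofReal (bump (k, j) y) :=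
        ENNReal.one_le_ofReal.2 (le_max_of_le_right (by simp only; linarith))
      calc (1 : ℝ≥0∞) = 1 * 1 := (one_mul 1).symm
        _ ≤ ENNReal.ofReal (bump (k, j) x) * ENNReal.ofReal (bump (k, j) y) := by gcongr
        _ ≤ _ := ENNReal.le_tsum (f := fun j : Fin n → ℤ =>
            ENNReal.ofReal (bump (k, j) x) * ENNReal.ofReal (bump (k, j) y)) j
    · rw [indicator_of_notMem (by exact hxy)]
      exact zero_le
  have hset : MeasurableSet {z : EuclideanSpace ℝ (Fin n) × EuclideanSpace ℝ (Fin n) |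
      dist z.1 z.2 ≤ (1 / 2) ^ k} :=
    measurableSet_le (measurable_fst.dist measurable_snd) measurable_const
  have hint : ∀ j : Fin n → ℤ, ∫⁻ x, ENNReal.ofReal (bump (k, j) x) ∂μ =
      ENNReal.ofReal (∫ x, bump (k, j) x ∂μ) := fun j => by
    refine (ofReal_integral_eq_lintegral_ofReal ?_ (Eventually.of_forall fun x =>
      bump_nonneg _ _)).symm
    refine Integrable.of_bound (continuous_bump _).aestronglyMeasurable 3
      (Eventually.of_forall fun x => ?_)
    rw [Real.norm_of_nonneg (bump_nonneg _ _)]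
    exact bump_le _ _
  calc _ = ∫⁻ z, {z : EuclideanSpace ℝ (Fin n) × EuclideanSpace ℝ (Fin n) |
        dist z.1 z.2 ≤ (1 / 2) ^ k}.indicator 1 z ∂(μ.prod μ) := (lintegral_indicator_one hset).symm
    _ ≤ ∫⁻ z, ∑' j : Fin n → ℤ,
        ENNReal.ofReal (bump (k, j) z.1) * ENNReal.ofReal (bump (k, j) z.2) ∂(μ.prod μ) :=
      lintegral_mono hpoint
    _ = ∑' j : Fin n → ℤ, ENNReal.ofReal ((∫ x, bump (k, j) x ∂μ) ^ 2) := by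
      have hprod : ∀ j : Fin n → ℤ, AEMeasurable (fun z : EuclideanSpace ℝ (Fin n) ×
          EuclideanSpace ℝ (Fin n) => ENNReal.ofReal (bump (k, j) z.1) *
            ENNReal.ofReal (bump (k, j) z.2)) (μ.prod μ) := fun j =>
        (((hmeas j).comp measurable_fst).mul ((hmeas j).comp measurable_snd)).aemeasurable
      rw [lintegral_tsum hprod]
      refine tsum_congr fun j => ?_
      rw [lintegral_prod_mul (hmeas j).aemeasurable (hmeas j).aemeasurable, hint, sq,
        ENNReal.ofReal_mul (integral_nonneg fun x => bump_nonneg _ _)]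
    _ ≤ ENNReal.ofReal (D / (q ^ 2) ^ k) := by
      rw [ENNReal.tsum_eq_iSup_sum]
      refine iSup_le fun s => ?_
      rw [← ENNReal.ofReal_sum_of_nonneg fun j _ => sq_nonneg _]
      refine ENNReal.ofReal_le_ofReal ?_
      rw [le_div_iff₀ (by positivity), Finset.sum_mul]
      -- Only generation `k` of the energy is used; its scaling contributes the factor `(q²)^k`.
      refine le_trans (le_of_eq ?_) (hD (s.map (Function.Embedding.sectR k _)))
      rw [Finset.sum_map]
      refine Finset.sum_congr rfl fun j _ => ?_
      simp only [Function.Embedding.sectR_apply, scaledBump]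
      rw [integral_const_mul]
      ring

/-- **Frostman's lemma**, in the form of a bound on the mass near the diagonal. -/
theorem exists_measure_prod_dist_le {E : Set (EuclideanSpace ℝ (Fin n))} (hE : MeasurableSet E)
    (hne : E.Nonempty) {s α : ℝ} (hsα : s < α) (hα : ENNReal.ofReal α ≤ dimH E) :
    ∃ t, s ≤ t ∧ ∃ K ⊆ E, IsCompact K ∧ ∃ μ : Measure (EuclideanSpace ℝ (Fin n)),
      IsProbabilityMeasure μ ∧ μ Kᶜ = 0 ∧ ∃ D : ℝ, ∀ r : ℝ, 0 < r →
        (μ.prod μ) {z | dist z.1 z.2 ≤ r} ≤ ENNReal.ofReal (D * r ^ t) := by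
  rcases lt_or_ge s 0 with hs | hs
  -- For negative `s` a point mass suffices, with exponent `t = 0`. This covers `α ≤ 0`, where the
  -- dimension hypothesis gives nothing.
  · obtain ⟨p, hp⟩ := hne
    refine ⟨0, hs.le, {p}, singleton_subset_iff.2 hp, isCompact_singleton,
      Measure.dirac p, inferInstance, by simp, 1, fun r hr => ?_⟩
    simpa using prob_le_one
  refine ⟨s, le_rfl, ?_⟩
  set t : ℝ := (s + α) / 2 with ht
  have hst : s < t := by rw [ht]; linarith
  have htα : t < α := by rw [ht]; linarith
  have ht0 : 0 < t := by linarith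
  have hH : μH[t] E ≠ 0 := by
    have : ((t.toNNReal : ℝ≥0) : ℝ≥0∞) < dimH E :=
      lt_of_lt_of_le ((ENNReal.ofReal_lt_ofReal_iff (by linarith)).2 htα) hα
    have := hausdorffMeasure_of_lt_dimH this
    rw [Real.coe_toNNReal t ht0.le] at this
    simp [this]
  obtain ⟨c, hc, hcap⟩ := exists_capGE_of_hausdorffMeasure_ne_zero hst ht0 hH
  set q : ℝ := (2 : ℝ) ^ (s / 2) with hq
  have hq0 : 0 < q := by positivity
  have hψ := fun i x => scaledBump_nonneg (n := n) hq0.le i x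
  obtain ⟨K, hKE, hK, hKcap⟩ := exists_isCompact_capGE hψ (continuous_scaledBump q)
    hE.analyticSet (half_lt_self hc) (half_pos hc) hcap
  obtain ⟨μ, hμ, hμ0, hμK, D, hD⟩ :=
    exists_measure_of_capGE hψ (continuous_scaledBump q) hK (half_pos hc) hKcap
  have hD0 : 0 ≤ D := by simpa using hD ∅
  set ν := (μ univ)⁻¹ • μ with hν
  have hνp : IsProbabilityMeasure ν := by
    have : NeZero μ := ⟨fun h => hμ0 (by simp [h])⟩
    exact isProbabilityMeasureSMul
  set m : ℝ := ((μ univ)⁻¹).toReal with hm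
  have hνint : ∀ i, ∫ x, scaledBump q i x ∂ν = m * ∫ x, scaledBump q i x ∂μ := fun i => by
    rw [hν, integral_smul_measure, smul_eq_mul]
  have hνD : ∀ s : Finset (ℕ × (Fin n → ℤ)), ∑ i ∈ s, (∫ x, scaledBump q i x ∂ν) ^ 2 ≤
      m ^ 2 * D := fun s => by
    simp_rw [hνint, mul_pow]
    rw [← Finset.mul_sum]
    gcongr
    exact hD s
  set D' : ℝ := m ^ 2 * D with hD'
  have hD'0 : 0 ≤ D' := by positivity
  have hq2 : q ^ 2 = 2 ^ s := by
    rw [hq, ← Real.rpow_natCast, ← Real.rpow_mul (by norm_num)]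
    congr 1; push_cast; ring
  -- In the constant, `1` handles `r ≥ 1` and `2^s` the rounding of `r` up to a power of `1/2`.
  refine ⟨K, hKE, hK, ν, hνp, by simp [hν, hμK], 1 + D' * 2 ^ s, fun r hr => ?_⟩
  rcases le_or_gt 1 r with hr1 | hr1
  · refine prob_le_one.trans (ENNReal.one_le_ofReal.2 ?_)
    have h1 : 1 ≤ r ^ s := Real.one_le_rpow hr1 hs
    have h2 : 0 ≤ D' * 2 ^ s * r ^ s := by positivity
    nlinarith
  · obtain ⟨k, hk1, hk2⟩ := exists_nat_pow_near_of_lt_one hr hr1.le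
      (show (0 : ℝ) < 1 / 2 by norm_num) (by norm_num)
    calc _ ≤ (ν.prod ν) {z | dist z.1 z.2 ≤ (1 / 2) ^ k} :=
          measure_mono fun z (hz : dist z.1 z.2 ≤ r) => hz.trans hk2
      _ ≤ ENNReal.ofReal (D' / (q ^ 2) ^ k) := prod_dist_le_of_energy hq0 ν hνD k
      _ ≤ _ := by
        refine ENNReal.ofReal_le_ofReal ?_
        have h1 : ((1 / 2 : ℝ) ^ (k + 1)) ^ s ≤ r ^ s := by gcongr
        have h2 : ((1 / 2 : ℝ) ^ (k + 1)) ^ s = ((2 : ℝ) ^ s)⁻¹ * ((q ^ 2) ^ k)⁻¹ := by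
          rw [hq2, ← mul_inv, ← pow_succ', one_div, inv_pow, Real.inv_rpow (by positivity),
            ← Real.rpow_natCast, ← Real.rpow_mul (by norm_num), mul_comm,
            Real.rpow_mul (by norm_num), Real.rpow_natCast]
        rw [h2] at h1
        have h3 : D' * (2 ^ s) * (((2 : ℝ) ^ s)⁻¹ * ((q ^ 2) ^ k)⁻¹) = D' / (q ^ 2) ^ k := by
          field_simp
        rw [← h3]
        have h4 : 0 ≤ r ^ s := by positivity
        calc _ ≤ D' * 2 ^ s * r ^ s := by gcongr
          _ ≤ _ := by nlinarith

end Lattice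

/-! ### Gaussian integrals against measures of polynomial growth. -/

section GaussianBounds

/-- The series that dominates Gaussian integrals against measures of polynomial growth. -/
def gaussianSeries (b β : ℝ) : ℝ≥0∞ :=
  ∑' m : ℕ, ENNReal.ofReal (((m : ℝ) + 2) ^ b * Real.exp (-Real.pi * (m : ℝ) ^ 2)) *
    ENNReal.ofReal (((m : ℝ) + 1) ^ β)

theorem gaussianSeries_lt_top (b β : ℝ) : gaussianSeries b β < ∞ := by
  obtain ⟨k, hk⟩ := exists_nat_ge (b + |β|)
  have hs : Summable fun m : ℕ => Real.exp 2 * (((m + 2 : ℕ) : ℝ) ^ k *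
      Real.exp (-1 * ((m + 2 : ℕ) : ℝ))) :=
    ((summable_nat_add_iff 2).2
      (Real.summable_pow_mul_exp_neg_nat_mul k one_pos)).mul_left _
  refine lt_of_le_of_lt (ENNReal.tsum_le_tsum fun m => ?_) hs.tsum_ofReal_lt_top
  rw [← ENNReal.ofReal_mul (by positivity)]
  refine ENNReal.ofReal_le_ofReal ?_
  have hm : (0 : ℝ) ≤ m := Nat.cast_nonneg m
  have h1 : ((m : ℝ) + 1) ^ β ≤ ((m : ℝ) + 2) ^ |β| :=
    calc ((m : ℝ) + 1) ^ β ≤ ((m : ℝ) + 1) ^ |β| :=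
          Real.rpow_le_rpow_of_exponent_le (by linarith) (le_abs_self β)
      _ ≤ _ := by gcongr; norm_num
  have h2 : ((m : ℝ) + 2) ^ b * ((m : ℝ) + 2) ^ |β| ≤ ((m : ℝ) + 2) ^ k := by
    rw [← Real.rpow_add (by linarith), ← Real.rpow_natCast]
    exact Real.rpow_le_rpow_of_exponent_le (by linarith) hk
  have h3 : Real.exp (-Real.pi * (m : ℝ) ^ 2) ≤ Real.exp 2 * Real.exp (-1 * ((m : ℝ) + 2)) := by
    rw [← Real.exp_add]
    refine Real.exp_le_exp.2 ?_
    have h4 : (m : ℝ) ≤ (m : ℝ) ^ 2 := by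
      exact_mod_cast Nat.le_self_pow (by norm_num) m
    nlinarith [Real.pi_gt_three]
  push_cast
  calc _ = Real.exp (-Real.pi * (m : ℝ) ^ 2) * (((m : ℝ) + 2) ^ b * ((m : ℝ) + 1) ^ β) := by ring
    _ ≤ (Real.exp 2 * Real.exp (-1 * ((m : ℝ) + 2))) *
        (((m : ℝ) + 2) ^ b * ((m : ℝ) + 2) ^ |β|) := by gcongr
    _ ≤ (Real.exp 2 * Real.exp (-1 * ((m : ℝ) + 2))) * ((m : ℝ) + 2) ^ k := by gcongr
    _ = _ := by ring

/-- Gaussian integrals against a measure whose sublevel sets grow polynomially. -/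
theorem lintegral_gaussian_le {Y : Type*} [MeasurableSpace Y] (ν : Measure Y) {u : Y → ℝ}
    (hu : Measurable u) (hu0 : ∀ y, 0 ≤ u y) {b β D : ℝ} (hb : 0 ≤ b)
    (h : ∀ r, 1 ≤ r → ν {y | u y ≤ r} ≤ ENNReal.ofReal (D * r ^ β)) :
    ∫⁻ y, ENNReal.ofReal ((1 + u y) ^ b * Real.exp (-Real.pi * u y ^ 2)) ∂ν ≤
      ENNReal.ofReal D * gaussianSeries b β := by
  set w : ℕ → ℝ≥0∞ := fun m =>
    ENNReal.ofReal (((m : ℝ) + 2) ^ b * Real.exp (-Real.pi * (m : ℝ) ^ 2)) with hw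
  have hset : ∀ m : ℕ, MeasurableSet {y | u y ≤ (m : ℝ) + 1} := fun m =>
    measurableSet_le hu measurable_const
  have hpoint : ∀ y, ENNReal.ofReal ((1 + u y) ^ b * Real.exp (-Real.pi * u y ^ 2)) ≤
      ∑' m : ℕ, w m * {y | u y ≤ (m : ℝ) + 1}.indicator 1 y := by
    intro y
    -- On the layer `m ≤ u < m + 1` the integrand is at most `w m`. The layers are enclosed in
    -- sublevel sets of radius `m + 1`, which is why only `r ≥ 1` matters.
    set m := ⌊u y⌋₊ with hm
    have h1 : (m : ℝ) ≤ u y := Nat.floor_le (hu0 y)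
    have h2 : u y < m + 1 := Nat.lt_floor_add_one _
    refine le_trans ?_ (ENNReal.le_tsum m)
    rw [indicator_of_mem (by exact h2.le), Pi.one_apply, mul_one]
    refine ENNReal.ofReal_le_ofReal ?_
    have h3 := hu0 y
    refine mul_le_mul (Real.rpow_le_rpow (by linarith) (by linarith) hb)
      (Real.exp_le_exp.2 ?_) (Real.exp_pos _).le (by positivity)
    have h4 : (m : ℝ) ^ 2 ≤ u y ^ 2 := by gcongr
    nlinarith [Real.pi_pos]
  calc _ ≤ ∫⁻ y, ∑' m : ℕ, w m * {y | u y ≤ (m : ℝ) + 1}.indicator 1 y ∂ν := lintegral_mono hpoint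
    _ = ∑' m : ℕ, w m * ν {y | u y ≤ (m : ℝ) + 1} := by
        rw [lintegral_tsum fun m =>
          ((measurable_one.indicator (hset m)).const_mul (w m)).aemeasurable]
        refine tsum_congr fun m => ?_
        rw [lintegral_const_mul _ (measurable_one.indicator (hset m)),
          lintegral_indicator_one (hset m)]
    _ ≤ ∑' m : ℕ, ENNReal.ofReal D * (w m * ENNReal.ofReal (((m : ℝ) + 1) ^ β)) := by
        refine ENNReal.tsum_le_tsum fun m => ?_
        calc _ ≤ w m * ENNReal.ofReal (D * ((m : ℝ) + 1) ^ β) := by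
              gcongr
              exact h _ (by linarith [Nat.cast_nonneg (α := ℝ) m])
          _ = _ := by
              rw [ENNReal.ofReal_mul' (by positivity)]; ring
    _ = _ := by rw [ENNReal.tsum_mul_left, gaussianSeries]

/-- Powers of comparable numbers are comparable. -/
theorem rpow_le_rpow_abs_mul {x y Q : ℝ} (hx : 0 < x) (hy : 0 < y) (hQ : 0 < Q) (hxy : x ≤ Q * y)
    (hyx : y ≤ Q * x) (a : ℝ) : x ^ a ≤ Q ^ |a| * y ^ a := by
  rcases le_total 0 a with ha | ha
  · rw [abs_of_nonneg ha, ← Real.mul_rpow hQ.le hy.le]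
    exact Real.rpow_le_rpow hx.le hxy ha
  · rw [abs_of_nonpos ha]
    have h1 : (Q * x) ^ a ≤ y ^ a := Real.rpow_le_rpow_of_nonpos hy hyx ha
    rw [Real.mul_rpow hQ.le hx.le] at h1
    calc x ^ a = Q ^ (-a) * (Q ^ a * x ^ a) := by
          rw [← mul_assoc, ← Real.rpow_add hQ, neg_add_cancel, Real.rpow_zero, one_mul]
      _ ≤ _ := by gcongr

end GaussianBounds

/-! ### Fourier transforms of measures and Fourier energy. -/

section Fourier

variable {d : ℕ}

theorem integrable_gaussian {b : ℝ} (hb : 0 < b) :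
    Integrable fun v : EuclideanSpace ℝ (Fin d) => Real.exp (-b * ‖v‖ ^ 2) := by
  have h := (GaussianFourier.integrable_cexp_neg_mul_sq_norm_add (V := EuclideanSpace ℝ (Fin d))
    (b := (b : ℂ)) (by simpa using hb) 0 0).norm
  refine h.congr (Eventually.of_forall fun v => ?_)
  simp only [zero_mul, add_zero, Complex.norm_exp]
  congr 1
  rw [← Complex.ofReal_neg, ← Complex.ofReal_pow, ← Complex.ofReal_mul, Complex.ofReal_re]

theorem integral_gaussian_mul_exp {ε : ℝ} (hε : 0 < ε) (z : EuclideanSpace ℝ (Fin d)) :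
    ∫ v : EuclideanSpace ℝ (Fin d), ((Real.exp (-(Real.pi * ε ^ 2) * ‖v‖ ^ 2) : ℝ) : ℂ) *
      Complex.exp (-2 * (Real.pi : ℂ) * Complex.I * ((⟪v, z⟫_ℝ : ℝ) : ℂ)) =
    (((ε⁻¹) ^ d * Real.exp (-Real.pi * (‖z‖ / ε) ^ 2) : ℝ) : ℂ) := by
  have hb : 0 < Real.pi * ε ^ 2 := by positivity
  have key := GaussianFourier.integral_cexp_neg_mul_sq_norm_add
    (V := EuclideanSpace ℝ (Fin d)) (b := ((Real.pi * ε ^ 2 : ℝ) : ℂ))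
    (by rwa [Complex.ofReal_re]) (-2 * Real.pi * Complex.I) z
  have e1 : ∀ v : EuclideanSpace ℝ (Fin d),
      ((Real.exp (-(Real.pi * ε ^ 2) * ‖v‖ ^ 2) : ℝ) : ℂ) *
        Complex.exp (-2 * (Real.pi : ℂ) * Complex.I * ((⟪v, z⟫_ℝ : ℝ) : ℂ)) =
      Complex.exp (-((Real.pi * ε ^ 2 : ℝ) : ℂ) * ‖v‖ ^ 2 +
        -2 * Real.pi * Complex.I * ((⟪z, v⟫_ℝ : ℝ) : ℂ)) := fun v => by
    rw [Complex.ofReal_exp, ← Complex.exp_add, real_inner_comm]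
    push_cast
    rfl
  simp_rw [e1]
  rw [key, finrank_euclideanSpace_fin]
  have e2 : ((Real.pi : ℂ) / ((Real.pi * ε ^ 2 : ℝ) : ℂ)) ^ ((d : ℂ) / 2) =
      (((ε⁻¹) ^ d : ℝ) : ℂ) := by
    have h1 : (Real.pi : ℂ) / ((Real.pi * ε ^ 2 : ℝ) : ℂ) = (((ε⁻¹) ^ 2 : ℝ) : ℂ) := by
      rw [← Complex.ofReal_div]
      congr 1
      field_simp
    have h2 : (d : ℂ) / 2 = ((d / 2 : ℝ) : ℂ) := by push_cast; rfl
    rw [h1, h2, ← Complex.ofReal_cpow (by positivity), ← Real.rpow_natCast,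
      ← Real.rpow_mul (by positivity), ← Real.rpow_natCast (ε⁻¹) d]
    congr 2
    push_cast
    ring
  have e3 : (-2 * (Real.pi : ℂ) * Complex.I) ^ 2 * (‖z‖ : ℂ) ^ 2 /
      (4 * ((Real.pi * ε ^ 2 : ℝ) : ℂ)) = ((-Real.pi * (‖z‖ / ε) ^ 2 : ℝ) : ℂ) := by
    have h1 : (Real.pi : ℂ) ≠ 0 := by exact_mod_cast Real.pi_ne_zero
    have h2 : (ε : ℂ) ≠ 0 := by exact_mod_cast hε.ne'
    push_cast
    rw [mul_pow, mul_pow, Complex.I_sq]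
    field_simp
    ring
  rw [e2, e3, Complex.ofReal_mul (ε⁻¹ ^ d), Complex.ofReal_exp]

theorem norm_fourierChar (ξ y : EuclideanSpace ℝ (Fin d)) :
    ‖Complex.exp (-2 * (Real.pi : ℂ) * Complex.I * ((⟪ξ, y⟫_ℝ : ℝ) : ℂ))‖ = 1 := by
  have : -2 * (Real.pi : ℂ) * Complex.I * ((⟪ξ, y⟫_ℝ : ℝ) : ℂ) =
      ((-2 * Real.pi * ⟪ξ, y⟫_ℝ : ℝ) : ℂ) * Complex.I := by push_cast; ring
  rw [this, Complex.norm_exp_ofReal_mul_I]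

theorem integrable_fourierChar (μ : Measure (EuclideanSpace ℝ (Fin d))) [IsFiniteMeasure μ]
    (ξ : EuclideanSpace ℝ (Fin d)) : Integrable (fun y =>
      Complex.exp (-2 * (Real.pi : ℂ) * Complex.I * ((⟪ξ, y⟫_ℝ : ℝ) : ℂ))) μ :=
  Integrable.of_bound (Continuous.aestronglyMeasurable (by fun_prop)) 1
    (Eventually.of_forall fun y => (norm_fourierChar ξ y).le)

theorem norm_measureFourier_le (μ : Measure (EuclideanSpace ℝ (Fin d))) [IsFiniteMeasure μ]
    (ξ : EuclideanSpace ℝ (Fin d)) : ‖measureFourier μ ξ‖ ≤ μ.real univ := by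
  have := norm_integral_le_of_norm_le_const (μ := μ) (C := 1)
    (Eventually.of_forall fun y => (norm_fourierChar ξ y).le)
  simpa [measureFourier] using this

theorem continuous_measureFourier (μ : Measure (EuclideanSpace ℝ (Fin d))) [IsFiniteMeasure μ] :
    Continuous (measureFourier μ) := by
  refine continuous_of_dominated (bound := fun _ => 1)
    (fun ξ => (integrable_fourierChar μ ξ).aestronglyMeasurable)
    (fun ξ => Eventually.of_forall fun y => (norm_fourierChar ξ y).le) (integrable_const _)
    (Eventually.of_forall fun y => by fun_prop)

theorem norm_measureFourier_sq (μ : Measure (EuclideanSpace ℝ (Fin d))) [IsFiniteMeasure μ]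
    (ξ : EuclideanSpace ℝ (Fin d)) : ((‖measureFourier μ ξ‖ ^ 2 : ℝ) : ℂ) =
      ∫ z, Complex.exp (-2 * (Real.pi : ℂ) * Complex.I * ((⟪ξ, z.1 - z.2⟫_ℝ : ℝ) : ℂ))
        ∂(μ.prod μ) := by
  have hconj : (starRingEnd ℂ) (measureFourier μ ξ) =
      ∫ y, Complex.exp (2 * (Real.pi : ℂ) * Complex.I * ((⟪ξ, y⟫_ℝ : ℝ) : ℂ)) ∂μ := by
    rw [measureFourier, ← integral_conj]
    refine integral_congr_ae (Eventually.of_forall fun y => ?_)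
    simp only
    rw [← Complex.exp_conj]
    congr 1
    have : (starRingEnd ℂ) 2 = 2 := Complex.conj_ofNat 2
    simp [this]
  have : ((‖measureFourier μ ξ‖ ^ 2 : ℝ) : ℂ) =
      measureFourier μ ξ * (starRingEnd ℂ) (measureFourier μ ξ) := by
    rw [Complex.mul_conj, Complex.normSq_eq_norm_sq]
  rw [this, hconj, measureFourier, ← integral_prod_mul]
  refine integral_congr_ae (Eventually.of_forall fun z => ?_)
  simp only
  rw [← Complex.exp_add, inner_sub_right]
  congr 1
  push_cast
  ring

/-- Fubini, since `|μ̂|²` is the transform of the law of `z.1 - z.2` under `μ×μ`. The energy of `μ̂`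
at frequencies up to about `1/ε` is thus governed by the mass of `μ×μ` within about `ε` of the
diagonal. -/
theorem integral_norm_measureFourier_sq_gaussian (μ : Measure (EuclideanSpace ℝ (Fin d)))
    [IsFiniteMeasure μ] {ε : ℝ} (hε : 0 < ε) :
    ∫ ξ, Real.exp (-(Real.pi * ε ^ 2) * ‖ξ‖ ^ 2) * ‖measureFourier μ ξ‖ ^ 2 =
      ∫ z, (ε⁻¹) ^ d * Real.exp (-Real.pi * (dist z.1 z.2 / ε) ^ 2) ∂(μ.prod μ) := by
  have hb : 0 < Real.pi * ε ^ 2 := by positivity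
  rw [← Complex.ofReal_inj, ← integral_complex_ofReal, ← integral_complex_ofReal]
  calc _ = ∫ ξ, ∫ z, ((Real.exp (-(Real.pi * ε ^ 2) * ‖ξ‖ ^ 2) : ℝ) : ℂ) *
        Complex.exp (-2 * (Real.pi : ℂ) * Complex.I * ((⟪ξ, z.1 - z.2⟫_ℝ : ℝ) : ℂ))
          ∂(μ.prod μ) := by
        refine integral_congr_ae (Eventually.of_forall fun ξ => ?_)
        simp only
        rw [integral_const_mul, ← norm_measureFourier_sq, Complex.ofReal_mul]
    _ = ∫ z, (∫ ξ, ((Real.exp (-(Real.pi * ε ^ 2) * ‖ξ‖ ^ 2) : ℝ) : ℂ) *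
        Complex.exp (-2 * (Real.pi : ℂ) * Complex.I * ((⟪ξ, z.1 - z.2⟫_ℝ : ℝ) : ℂ)))
          ∂(μ.prod μ) := by
        refine integral_integral_swap ?_
        have hg : Integrable (fun w : EuclideanSpace ℝ (Fin d) ×
            (EuclideanSpace ℝ (Fin d) × EuclideanSpace ℝ (Fin d)) =>
            Real.exp (-(Real.pi * ε ^ 2) * ‖w.1‖ ^ 2) * 1) (volume.prod (μ.prod μ)) :=
          (integrable_gaussian hb).mul_prod (integrable_const (1 : ℝ))
        refine hg.mono' ?_ (Eventually.of_forall fun w => ?_)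
        · refine Continuous.aestronglyMeasurable ?_
          simp only [Function.uncurry_def]
          fun_prop
        · simp only [Function.uncurry_def]
          rw [norm_mul, norm_fourierChar, Complex.norm_real, Real.norm_of_nonneg (Real.exp_pos _).le]
    _ = _ := by
        refine integral_congr_ae (Eventually.of_forall fun z => ?_)
        simp only
        rw [integral_gaussian_mul_exp hε, dist_eq_norm]

theorem lintegral_norm_measureFourier_sq_gaussian (μ : Measure (EuclideanSpace ℝ (Fin d)))
    [IsFiniteMeasure μ] {ε : ℝ} (hε : 0 < ε) :
    ∫⁻ ξ, ENNReal.ofReal (Real.exp (-(Real.pi * ε ^ 2) * ‖ξ‖ ^ 2) * ‖measureFourier μ ξ‖ ^ 2) =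
      ENNReal.ofReal ((ε⁻¹) ^ d) *
        ∫⁻ z, ENNReal.ofReal (Real.exp (-Real.pi * (dist z.1 z.2 / ε) ^ 2)) ∂(μ.prod μ) := by
  have hb : 0 < Real.pi * ε ^ 2 := by positivity
  rw [← ofReal_integral_eq_lintegral_ofReal, integral_norm_measureFourier_sq_gaussian μ hε,
    integral_const_mul, ENNReal.ofReal_mul (by positivity), ofReal_integral_eq_lintegral_ofReal]
  · refine Integrable.of_bound (Continuous.aestronglyMeasurable (by fun_prop)) 1
      (Eventually.of_forall fun z => ?_)
    rw [Real.norm_of_nonneg (Real.exp_pos _).le]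
    refine Real.exp_le_one_iff.2 ?_
    have : 0 ≤ (dist z.1 z.2 / ε) ^ 2 := by positivity
    nlinarith [Real.pi_pos]
  · exact Eventually.of_forall fun z => (Real.exp_pos _).le
  · refine ((integrable_gaussian hb).mul_const (μ.real univ ^ 2)).mono'
      (Continuous.aestronglyMeasurable ?_) (Eventually.of_forall fun ξ => ?_)
    · have := continuous_measureFourier μ
      fun_prop
    · rw [Real.norm_of_nonneg (by positivity)]
      gcongr
      exact norm_measureFourier_le μ ξ
  · exact Eventually.of_forall fun ξ => by positivity

/-- One term is enough: if `2^k ≤ 1 + x < 2^(k+1)`, then `(1+x)^a` and `2^(ka)` agree up to `2^|a|`,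
and `2^(-k) x ≤ 2` keeps the Gaussian above `exp(-4π)`. -/
theorem one_add_norm_rpow_le_tsum (a x : ℝ) (hx : 0 ≤ x) :
    ENNReal.ofReal ((1 + x) ^ a) ≤ ENNReal.ofReal ((2 : ℝ) ^ |a| * Real.exp (4 * Real.pi)) *
      ∑' k : ℕ, ENNReal.ofReal (((2 : ℝ) ^ k) ^ a) *
        ENNReal.ofReal (Real.exp (-(Real.pi * ((1 / 2 : ℝ) ^ k) ^ 2) * x ^ 2)) := by
  obtain ⟨k, hk1, hk2⟩ := exists_nat_pow_near (show (1 : ℝ) ≤ 1 + x by linarith) one_lt_two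
  refine le_trans ?_ (mul_le_mul_right (ENNReal.le_tsum k) _)
  rw [← ENNReal.ofReal_mul (by positivity), ← ENNReal.ofReal_mul (by positivity)]
  refine ENNReal.ofReal_le_ofReal ?_
  have h2k : (0 : ℝ) < 2 ^ k := by positivity
  have h1 : (1 + x) ^ a ≤ (2 : ℝ) ^ |a| * ((2 : ℝ) ^ k) ^ a :=
    rpow_le_rpow_abs_mul (by linarith) h2k two_pos (by rw [pow_succ] at hk2; linarith)
      (by linarith) a
  have h2 : 1 ≤ Real.exp (4 * Real.pi) *
      Real.exp (-(Real.pi * ((1 / 2 : ℝ) ^ k) ^ 2) * x ^ 2) := by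
    rw [← Real.exp_add]
    refine Real.one_le_exp ?_
    have h3 : (1 / 2 : ℝ) ^ k * x ≤ 2 := by
      rw [one_div, inv_pow, inv_mul_le_iff₀ h2k]
      rw [pow_succ] at hk2
      linarith
    have h4 : 0 ≤ (1 / 2 : ℝ) ^ k * x := by positivity
    have h5 : ((1 / 2 : ℝ) ^ k * x) ^ 2 ≤ 2 ^ 2 := by gcongr
    rw [mul_pow] at h5
    nlinarith [Real.pi_pos]
  calc (1 + x) ^ a ≤ (2 : ℝ) ^ |a| * ((2 : ℝ) ^ k) ^ a * 1 := by rwa [mul_one]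
    _ ≤ (2 : ℝ) ^ |a| * ((2 : ℝ) ^ k) ^ a * (Real.exp (4 * Real.pi) *
      Real.exp (-(Real.pi * ((1 / 2 : ℝ) ^ k) ^ 2) * x ^ 2)) := by gcongr
    _ = _ := by ring

/-- Mass bounds near the diagonal give finite Fourier energy of every smaller order. -/
theorem lintegral_fourier_energy_lt_top (μ : Measure (EuclideanSpace ℝ (Fin d)))
    [IsFiniteMeasure μ] {D t a : ℝ} (hat : a + d < t)
    (h : ∀ r : ℝ, 0 < r → (μ.prod μ) {z | dist z.1 z.2 ≤ r} ≤ ENNReal.ofReal (D * r ^ t)) :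
    ∫⁻ ξ, ENNReal.ofReal ((1 + ‖ξ‖) ^ a) * ENNReal.ofReal (‖measureFourier μ ξ‖ ^ 2) < ∞ := by
  set C := ENNReal.ofReal ((2 : ℝ) ^ |a| * Real.exp (4 * Real.pi)) with hC
  have hmeasF : Measurable fun ξ => ENNReal.ofReal (‖measureFourier μ ξ‖ ^ 2) :=
    ((continuous_measureFourier μ).norm.pow 2).measurable.ennreal_ofReal
  have hmeasG : ∀ k : ℕ, Measurable fun ξ : EuclideanSpace ℝ (Fin d) =>
      ENNReal.ofReal (Real.exp (-(Real.pi * ((1 / 2 : ℝ) ^ k) ^ 2) * ‖ξ‖ ^ 2)) := fun k =>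
    (Continuous.measurable (by fun_prop)).ennreal_ofReal
  have hk : ∀ k : ℕ, ∫⁻ ξ, ENNReal.ofReal
      (Real.exp (-(Real.pi * ((1 / 2 : ℝ) ^ k) ^ 2) * ‖ξ‖ ^ 2)) *
        ENNReal.ofReal (‖measureFourier μ ξ‖ ^ 2) ≤
      ENNReal.ofReal (((2 : ℝ) ^ k) ^ d) *
        (ENNReal.ofReal (D * ((1 / 2 : ℝ) ^ k) ^ t) * gaussianSeries 0 t) := by
    intro k
    set ε : ℝ := (1 / 2 : ℝ) ^ k with hε
    have hε0 : 0 < ε := by positivity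
    simp_rw [← ENNReal.ofReal_mul (Real.exp_pos _).le]
    rw [lintegral_norm_measureFourier_sq_gaussian μ hε0]
    have hεinv : ε⁻¹ = 2 ^ k := by rw [hε, one_div, inv_pow, inv_inv]
    rw [hεinv]
    gcongr
    have := lintegral_gaussian_le (μ.prod μ) (u := fun z => dist z.1 z.2 / ε) (b := 0) (β := t)
      (D := D * ε ^ t) ((measurable_fst.dist measurable_snd).div_const ε)
      (fun z => by positivity) le_rfl (fun r hr => by
        have hr0 : 0 < r := by linarith
        have e : {z : EuclideanSpace ℝ (Fin d) × EuclideanSpace ℝ (Fin d) |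
            dist z.1 z.2 / ε ≤ r} = {z | dist z.1 z.2 ≤ ε * r} := by
          ext z
          simp only [Set.mem_ofPred_eq]
          rw [div_le_iff₀ hε0, mul_comm]
        rw [e, mul_assoc, ← Real.mul_rpow hε0.le hr0.le]
        exact h _ (by positivity))
    simpa using this
  have hgeo : ∑' k : ℕ, ENNReal.ofReal (((2 : ℝ) ^ k) ^ a) * (ENNReal.ofReal (((2 : ℝ) ^ k) ^ d) *
        (ENNReal.ofReal (D * ((1 / 2 : ℝ) ^ k) ^ t) * gaussianSeries 0 t)) < ∞ := by
    -- Scale `k` contributes `2^(ka)` from the weight, `2^(kd)` from the Gaussian normalization and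
    -- `2^(-kt)` from the mass bound, so `a + d < t` makes the series geometric.
    set ρ : ℝ := (2 : ℝ) ^ (a + d - t) with hρ
    have hρ0 : 0 < ρ := by positivity
    have hρ1 : ρ < 1 := Real.rpow_lt_one_of_one_lt_of_neg one_lt_two (by linarith)
    have e : ∀ k : ℕ, ENNReal.ofReal (((2 : ℝ) ^ k) ^ a) * (ENNReal.ofReal (((2 : ℝ) ^ k) ^ d) *
        (ENNReal.ofReal (D * ((1 / 2 : ℝ) ^ k) ^ t) * gaussianSeries 0 t)) =
        ENNReal.ofReal (D * ρ ^ k) * gaussianSeries 0 t := by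
      intro k
      rw [← mul_assoc, ← mul_assoc, ← ENNReal.ofReal_mul (by positivity),
        ← ENNReal.ofReal_mul (by positivity)]
      congr 2
      have e1 : (1 / 2 : ℝ) = (2 : ℝ) ^ (-1 : ℝ) := by rw [Real.rpow_neg_one]; norm_num
      have : ((2 : ℝ) ^ k) ^ a * ((2 : ℝ) ^ k) ^ d * ((1 / 2 : ℝ) ^ k) ^ t = ρ ^ k := by
        rw [hρ, e1]
        simp only [← Real.rpow_natCast, ← Real.rpow_mul (show (0 : ℝ) ≤ 2 by norm_num)]
        rw [← Real.rpow_add two_pos, ← Real.rpow_add two_pos]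
        congr 1
        ring
      rw [← this]
      ring
    simp_rw [e]
    rw [ENNReal.tsum_mul_right]
    exact ENNReal.mul_lt_top
      ((summable_geometric_of_lt_one hρ0.le hρ1).mul_left D).tsum_ofReal_lt_top
      (gaussianSeries_lt_top 0 t)
  calc _ ≤ ∫⁻ ξ, C * ∑' k : ℕ, ENNReal.ofReal (((2 : ℝ) ^ k) ^ a) *
        (ENNReal.ofReal (Real.exp (-(Real.pi * ((1 / 2 : ℝ) ^ k) ^ 2) * ‖ξ‖ ^ 2)) *
          ENNReal.ofReal (‖measureFourier μ ξ‖ ^ 2)) := by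
        refine lintegral_mono fun ξ => ?_
        simp_rw [← mul_assoc]
        rw [ENNReal.tsum_mul_right, ← mul_assoc]
        gcongr
        exact one_add_norm_rpow_le_tsum a ‖ξ‖ (norm_nonneg ξ)
    _ = C * ∑' k : ℕ, ENNReal.ofReal (((2 : ℝ) ^ k) ^ a) *
        ∫⁻ ξ, ENNReal.ofReal (Real.exp (-(Real.pi * ((1 / 2 : ℝ) ^ k) ^ 2) * ‖ξ‖ ^ 2)) *
          ENNReal.ofReal (‖measureFourier μ ξ‖ ^ 2) := by
        have hmeas : ∀ k : ℕ, AEMeasurable fun ξ => ENNReal.ofReal (((2 : ℝ) ^ k) ^ a) *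
            (ENNReal.ofReal (Real.exp (-(Real.pi * ((1 / 2 : ℝ) ^ k) ^ 2) * ‖ξ‖ ^ 2)) *
              ENNReal.ofReal (‖measureFourier μ ξ‖ ^ 2)) := fun k =>
          (((hmeasG k).mul hmeasF).const_mul _).aemeasurable
        rw [lintegral_const_mul' _ _ ENNReal.ofReal_ne_top, lintegral_tsum hmeas]
        congr 1
        refine tsum_congr fun k => ?_
        rw [lintegral_const_mul' _ _ ENNReal.ofReal_ne_top]
    _ ≤ C * ∑' k : ℕ, ENNReal.ofReal (((2 : ℝ) ^ k) ^ a) * (ENNReal.ofReal (((2 : ℝ) ^ k) ^ d) *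
        (ENNReal.ofReal (D * ((1 / 2 : ℝ) ^ k) ^ t) * gaussianSeries 0 t)) := by
        gcongr with k
        exact hk k
    _ < ∞ := ENNReal.mul_lt_top ENNReal.ofReal_lt_top hgeo

end Fourier

/-! ### The Gaussian cutoff and local averages of `μ̂`. -/

section Localization

variable {d : ℕ}

/-- The measure with Gaussian density with respect to `μ`. -/
def gaussianCutoff (μ : Measure (EuclideanSpace ℝ (Fin d))) :
    Measure (EuclideanSpace ℝ (Fin d)) :=
  μ.withDensity fun p => ENNReal.ofReal (Real.exp (-Real.pi * ‖p‖ ^ 2))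

theorem exp_neg_pi_sq_le_one (x : ℝ) : Real.exp (-Real.pi * x ^ 2) ≤ 1 :=
  Real.exp_le_one_iff.2 (by nlinarith [Real.pi_pos, sq_nonneg x])

theorem measurable_gaussian : Measurable fun p : EuclideanSpace ℝ (Fin d) =>
    ENNReal.ofReal (Real.exp (-Real.pi * ‖p‖ ^ 2)) :=
  (Continuous.measurable (by fun_prop)).ennreal_ofReal

theorem isFiniteMeasure_gaussianCutoff (μ : Measure (EuclideanSpace ℝ (Fin d)))
    [IsFiniteMeasure μ] : IsFiniteMeasure (gaussianCutoff μ) := by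
  refine isFiniteMeasure_withDensity ?_
  refine ne_top_of_le_ne_top (b := μ univ) (measure_ne_top μ univ) ?_
  calc _ ≤ ∫⁻ _, 1 ∂μ := lintegral_mono fun p => by
        simpa using exp_neg_pi_sq_le_one ‖p‖
    _ = μ univ := by simp

theorem gaussianCutoff_univ_ne_zero (μ : Measure (EuclideanSpace ℝ (Fin d)))
    (hμ : μ ≠ 0) : gaussianCutoff μ univ ≠ 0 := by
  rw [gaussianCutoff, withDensity_apply _ MeasurableSet.univ, Measure.restrict_univ]
  intro h
  rw [lintegral_eq_zero_iff measurable_gaussian] at h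
  refine hμ (Measure.measure_univ_eq_zero.1 ?_)
  have : {p : EuclideanSpace ℝ (Fin d) |
      ¬ ENNReal.ofReal (Real.exp (-Real.pi * ‖p‖ ^ 2)) = 0} = univ := by
    ext p
    simp [Real.exp_pos]
  rw [← this]
  exact h

/-- The Gaussian is its own Fourier transform, so the product with it becomes a convolution. This
controls values of the transform on lower-dimensional graphs by averages of `μ̂` over unit
neighbourhoods. -/
theorem measureFourier_gaussianCutoff (μ : Measure (EuclideanSpace ℝ (Fin d)))
    [IsFiniteMeasure μ] (ζ : EuclideanSpace ℝ (Fin d)) :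
    measureFourier (gaussianCutoff μ) ζ =
      ∫ η, ((Real.exp (-Real.pi * ‖ζ - η‖ ^ 2) : ℝ) : ℂ) * measureFourier μ η := by
  have hg : ∀ p : EuclideanSpace ℝ (Fin d), ((Real.exp (-Real.pi * ‖p‖ ^ 2) : ℝ) : ℂ) =
      ∫ v : EuclideanSpace ℝ (Fin d), ((Real.exp (-Real.pi * ‖v‖ ^ 2) : ℝ) : ℂ) *
        Complex.exp (-2 * (Real.pi : ℂ) * Complex.I * ((⟪v, -p⟫_ℝ : ℝ) : ℂ)) := fun p => by
    have := integral_gaussian_mul_exp one_pos (-p)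
    simpa using this.symm
  have hgint : Integrable fun v : EuclideanSpace ℝ (Fin d) => Real.exp (-Real.pi * ‖v‖ ^ 2) :=
    integrable_gaussian Real.pi_pos
  calc measureFourier (gaussianCutoff μ) ζ
      = ∫ p, ((Real.exp (-Real.pi * ‖p‖ ^ 2) : ℝ) : ℂ) *
          Complex.exp (-2 * (Real.pi : ℂ) * Complex.I * ((⟪ζ, p⟫_ℝ : ℝ) : ℂ)) ∂μ := by
        rw [measureFourier, gaussianCutoff,
          integral_withDensity_eq_integral_toReal_smul measurable_gaussian
            (Eventually.of_forall fun p => ENNReal.ofReal_lt_top)]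
        refine integral_congr_ae (Eventually.of_forall fun p => ?_)
        simp only
        rw [ENNReal.toReal_ofReal (Real.exp_pos _).le, Complex.real_smul]
    _ = ∫ p, (∫ v : EuclideanSpace ℝ (Fin d), ((Real.exp (-Real.pi * ‖v‖ ^ 2) : ℝ) : ℂ) *
          Complex.exp (-2 * (Real.pi : ℂ) * Complex.I * ((⟪ζ - v, p⟫_ℝ : ℝ) : ℂ))) ∂μ := by
        refine integral_congr_ae (Eventually.of_forall fun p => ?_)
        simp only
        rw [hg, ← integral_mul_const]
        refine integral_congr_ae (Eventually.of_forall fun v => ?_)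
        simp only
        rw [mul_assoc, ← Complex.exp_add, inner_neg_right, inner_sub_left]
        congr 2
        push_cast
        ring
    _ = ∫ v : EuclideanSpace ℝ (Fin d), (∫ p, ((Real.exp (-Real.pi * ‖v‖ ^ 2) : ℝ) : ℂ) *
          Complex.exp (-2 * (Real.pi : ℂ) * Complex.I * ((⟪ζ - v, p⟫_ℝ : ℝ) : ℂ)) ∂μ) := by
        refine integral_integral_swap ?_
        have h1 : Integrable (fun w : EuclideanSpace ℝ (Fin d) × EuclideanSpace ℝ (Fin d) =>
            1 * Real.exp (-Real.pi * ‖w.2‖ ^ 2)) (μ.prod volume) :=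
          (integrable_const (1 : ℝ)).mul_prod hgint
        refine h1.mono' ?_ (Eventually.of_forall fun w => ?_)
        · refine Continuous.aestronglyMeasurable ?_
          simp only [Function.uncurry_def]
          fun_prop
        · simp only [Function.uncurry_def]
          rw [norm_mul, norm_fourierChar, Complex.norm_real,
            Real.norm_of_nonneg (Real.exp_pos _).le, mul_comm]
    _ = ∫ v : EuclideanSpace ℝ (Fin d), ((Real.exp (-Real.pi * ‖v‖ ^ 2) : ℝ) : ℂ) *
          measureFourier μ (ζ - v) := by
        simp_rw [integral_const_mul]
        rfl
    _ = _ := by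
        rw [← integral_sub_left_eq_self _ volume ζ]
        simp

/-- Jensen's inequality for the convolution of `μ̂` with a Gaussian. -/
theorem norm_measureFourier_gaussianCutoff_sq_le (μ : Measure (EuclideanSpace ℝ (Fin d)))
    [IsFiniteMeasure μ] (ζ : EuclideanSpace ℝ (Fin d)) :
    ENNReal.ofReal (‖measureFourier (gaussianCutoff μ) ζ‖ ^ 2) ≤
      ∫⁻ η, ENNReal.ofReal (Real.exp (-Real.pi * ‖ζ - η‖ ^ 2) * ‖measureFourier μ η‖ ^ 2) := by
  set γ : EuclideanSpace ℝ (Fin d) → ℝ := fun η => Real.exp (-Real.pi * ‖ζ - η‖ ^ 2) with hγ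
  have hγ0 : ∀ η, 0 < γ η := fun η => Real.exp_pos _
  have hγint : Integrable γ :=
    (integrable_gaussian Real.pi_pos).comp_sub_left ζ
  have hγ1 : ∫ η, γ η = 1 := by
    have h1 := integral_sub_left_eq_self
      (fun v : EuclideanSpace ℝ (Fin d) => Real.exp (-Real.pi * ‖v‖ ^ 2)) volume ζ
    have h2 := GaussianFourier.integral_rexp_neg_mul_sq_norm (V := EuclideanSpace ℝ (Fin d))
      Real.pi_pos
    rw [div_self Real.pi_ne_zero, Real.one_rpow] at h2
    exact h1.trans h2
  have hcont := continuous_measureFourier μ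
  have hγc : Continuous γ := by simp only [hγ]; fun_prop
  have hi1 : Integrable fun η => γ η * ‖measureFourier μ η‖ := by
    refine (hγint.mul_const (μ.real univ)).mono' (hγc.mul hcont.norm).aestronglyMeasurable
      (Eventually.of_forall fun η => ?_)
    rw [Real.norm_of_nonneg (mul_nonneg (hγ0 η).le (norm_nonneg _))]
    exact mul_le_mul_of_nonneg_left (norm_measureFourier_le μ η) (hγ0 η).le
  have hi2 : Integrable fun η => γ η * ‖measureFourier μ η‖ ^ 2 := by
    refine (hγint.mul_const (μ.real univ ^ 2)).mono'
      (hγc.mul (hcont.norm.pow 2)).aestronglyMeasurable (Eventually.of_forall fun η => ?_)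
    rw [Real.norm_of_nonneg (mul_nonneg (hγ0 η).le (sq_nonneg _))]
    refine mul_le_mul_of_nonneg_left ?_ (hγ0 η).le
    gcongr
    exact norm_measureFourier_le μ η
  rw [← ofReal_integral_eq_lintegral_ofReal hi2
    (Eventually.of_forall fun η => mul_nonneg (hγ0 η).le (sq_nonneg _))]
  refine ENNReal.ofReal_le_ofReal ?_
  set m := ∫ η, γ η * ‖measureFourier μ η‖ with hm
  have h1 : ‖measureFourier (gaussianCutoff μ) ζ‖ ≤ m := by
    rw [measureFourier_gaussianCutoff]
    refine (norm_integral_le_integral_norm _).trans (le_of_eq ?_)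
    refine integral_congr_ae (Eventually.of_forall fun η => ?_)
    simp only
    rw [norm_mul, Complex.norm_real, Real.norm_of_nonneg (Real.exp_pos _).le]
  -- Jensen as nonnegativity of the variance, with respect to the Gaussian of total mass one.
  have h2 : 0 ≤ ∫ η, γ η * (‖measureFourier μ η‖ - m) ^ 2 :=
    integral_nonneg fun η => mul_nonneg (hγ0 η).le (sq_nonneg _)
  have h3 : ∫ η, γ η * (‖measureFourier μ η‖ - m) ^ 2 =
      (∫ η, γ η * ‖measureFourier μ η‖ ^ 2) - 2 * m * m + m ^ 2 := by
    have e : ∀ η, γ η * (‖measureFourier μ η‖ - m) ^ 2 =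
        γ η * ‖measureFourier μ η‖ ^ 2 - 2 * m * (γ η * ‖measureFourier μ η‖) + m ^ 2 * γ η :=
      fun η => by ring
    simp_rw [e]
    have hi3 : Integrable fun η =>
        γ η * ‖measureFourier μ η‖ ^ 2 - 2 * m * (γ η * ‖measureFourier μ η‖) :=
      hi2.sub (hi1.const_mul _)
    rw [integral_add hi3 (hγint.const_mul _), integral_sub hi2 (hi1.const_mul _), integral_const_mul, integral_const_mul, hγ1, mul_one]
  calc _ ≤ m ^ 2 := by gcongr
    _ ≤ _ := by nlinarith

end Localization

/-! ### Splitting of coordinates and the adjoint of the projection. -/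

section Coordinates

variable {n ℓ : ℕ}

theorem sum_fin_split (h : ℓ ≤ n) (f : Fin n → ℝ) :
    ∑ i, f i = ∑ i : Fin ℓ, f ⟨i.1, by omega⟩ + ∑ j : Fin (n - ℓ), f ⟨ℓ + j.1, by omega⟩ := by
  rw [← Fin.sum_congr' f (Nat.add_sub_cancel' h), Fin.sum_univ_add]
  rfl

/-- The first `ℓ` coordinates. -/
def headPart (h : ℓ ≤ n) (p : EuclideanSpace ℝ (Fin n)) : EuclideanSpace ℝ (Fin ℓ) :=
  WithLp.toLp 2 fun i => p ⟨i.1, by omega⟩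

/-- The last `n - ℓ` coordinates. -/
def tailPart (p : EuclideanSpace ℝ (Fin n)) : EuclideanSpace ℝ (Fin (n - ℓ)) :=
  WithLp.toLp 2 fun j => p ⟨ℓ + j.1, by omega⟩

/-- The adjoint of `projMap`, `ξ ↦ (ξ, T_x ξ)`. -/
def adjMap (x : EuclideanSpace ℝ (Fin ℓ × Fin (n - ℓ)))
    (ξ : EuclideanSpace ℝ (Fin ℓ)) : EuclideanSpace ℝ (Fin n) :=
  WithLp.toLp 2 fun i => if hi : i.1 < ℓ then ξ ⟨i.1, hi⟩ else dualMap x ξ ⟨i.1 - ℓ, by omega⟩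

theorem norm_sq_split (h : ℓ ≤ n) (p : EuclideanSpace ℝ (Fin n)) :
    ‖p‖ ^ 2 = ‖headPart h p‖ ^ 2 + ‖tailPart (ℓ := ℓ) p‖ ^ 2 := by
  simp only [EuclideanSpace.real_norm_sq_eq]
  exact sum_fin_split h fun i => p i ^ 2

theorem headPart_adjMap_sub (h : ℓ ≤ n) (x : EuclideanSpace ℝ (Fin ℓ × Fin (n - ℓ)))
    (ξ : EuclideanSpace ℝ (Fin ℓ)) (η : EuclideanSpace ℝ (Fin n)) :
    headPart h (adjMap x ξ - η) = ξ - headPart h η := by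
  ext i
  simp [headPart, adjMap]

theorem tailPart_adjMap_sub (x : EuclideanSpace ℝ (Fin ℓ × Fin (n - ℓ)))
    (ξ : EuclideanSpace ℝ (Fin ℓ)) (η : EuclideanSpace ℝ (Fin n)) :
    tailPart (ℓ := ℓ) (adjMap x ξ - η) = dualMap x ξ - tailPart η := by
  ext i
  simp [tailPart, adjMap]

theorem inner_projMap (h : ℓ ≤ n) (x : EuclideanSpace ℝ (Fin ℓ × Fin (n - ℓ)))
    (ξ : EuclideanSpace ℝ (Fin ℓ)) (p : EuclideanSpace ℝ (Fin n)) :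
    ⟪ξ, projMap h x p⟫_ℝ = ⟪adjMap x ξ, p⟫_ℝ := by
  simp only [PiLp.inner_apply, RCLike.inner_apply, conj_trivial]
  rw [sum_fin_split h]
  simp only [projMap, adjMap, dualMap, Fin.is_lt, dite_true, Fin.eta, add_mul,
    Finset.sum_add_distrib, Nat.not_lt.2 (Nat.le_add_right ℓ _), dite_false,
    Nat.add_sub_cancel_left]
  congr 1
  simp_rw [Finset.sum_mul, Finset.mul_sum]
  rw [Finset.sum_comm]
  exact Finset.sum_congr rfl fun j _ => Finset.sum_congr rfl fun i _ => by ring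

/-- Cauchy–Schwarz: the operator norm is at most the Hilbert–Schmidt norm, which is the Euclidean
norm of `x`. -/
theorem norm_dualMap_le (x : EuclideanSpace ℝ (Fin ℓ × Fin (n - ℓ)))
    (ξ : EuclideanSpace ℝ (Fin ℓ)) : ‖dualMap x ξ‖ ≤ ‖x‖ * ‖ξ‖ := by
  refine le_of_sq_le_sq ?_ (by positivity)
  rw [mul_pow]
  simp only [EuclideanSpace.real_norm_sq_eq]
  rw [Fintype.sum_prod_type_right, Finset.sum_mul]
  refine Finset.sum_le_sum fun j _ => ?_
  exact Finset.sum_mul_sq_le_sq_mul_sq (Finset.univ : Finset (Fin ℓ)) (fun i => x (i, j)) ξ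

theorem dualMap_smul (x : EuclideanSpace ℝ (Fin ℓ × Fin (n - ℓ))) (c : ℝ)
    (ξ : EuclideanSpace ℝ (Fin ℓ)) : dualMap x (c • ξ) = c • dualMap x ξ := by
  ext j
  simp only [dualMap, PiLp.smul_apply, smul_eq_mul, Finset.mul_sum]
  exact Finset.sum_congr rfl fun i _ => by ring

theorem continuous_dualMap : Continuous fun z : EuclideanSpace ℝ (Fin ℓ × Fin (n - ℓ)) ×
    EuclideanSpace ℝ (Fin ℓ) => dualMap z.1 z.2 := by
  unfold dualMap
  fun_prop

theorem continuous_adjMap : Continuous fun z : EuclideanSpace ℝ (Fin ℓ × Fin (n - ℓ)) ×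
    EuclideanSpace ℝ (Fin ℓ) => adjMap z.1 z.2 := by
  refine (PiLp.continuous_toLp 2 (fun _ : Fin n => ℝ)).comp (continuous_pi fun i => ?_)
  by_cases hi : i.1 < ℓ
  · simp only [hi, dite_true]
    fun_prop
  · simp only [hi, dite_false]
    have := continuous_dualMap (n := n) (ℓ := ℓ)
    fun_prop

theorem continuous_projMap (h : ℓ ≤ n) (x : EuclideanSpace ℝ (Fin ℓ × Fin (n - ℓ))) :
    Continuous (projMap h x) := by
  unfold projMap
  fun_prop

/-- Adjointness (`inner_projMap`): projecting a measure restricts its transform to the graph of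
`T_x`. -/
theorem measureFourier_map_projMap (h : ℓ ≤ n) (x : EuclideanSpace ℝ (Fin ℓ × Fin (n - ℓ)))
    (μ : Measure (EuclideanSpace ℝ (Fin n))) (ξ : EuclideanSpace ℝ (Fin ℓ)) :
    measureFourier (μ.map (projMap h x)) ξ = measureFourier μ (adjMap x ξ) := by
  rw [measureFourier, integral_map (continuous_projMap h x).aemeasurable
    (Continuous.aestronglyMeasurable (by fun_prop)), measureFourier]
  simp_rw [inner_projMap]

end Coordinates

/-! ### The averaged Gaussian kernel. -/

section KernelEstimate

variable {n ℓ : ℕ}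

theorem lintegral_volume_gaussian_le {d : ℕ} {b : ℝ} (hb : 0 ≤ b) :
    ∃ V : ℝ≥0∞, V < ∞ ∧ ∀ q : EuclideanSpace ℝ (Fin d),
      ∫⁻ ξ, ENNReal.ofReal ((1 + ‖ξ - q‖) ^ b * Real.exp (-Real.pi * ‖ξ - q‖ ^ 2)) ≤ V := by
  set v := volume (Metric.ball (0 : EuclideanSpace ℝ (Fin d)) 1) with hv
  have hvt : v ≠ ∞ := measure_ball_lt_top.ne
  refine ⟨ENNReal.ofReal v.toReal * gaussianSeries b d,
    ENNReal.mul_lt_top ENNReal.ofReal_lt_top (gaussianSeries_lt_top b d), fun q => ?_⟩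
  refine lintegral_gaussian_le volume (u := fun ξ => ‖ξ - q‖)
    (Continuous.measurable (by fun_prop)) (fun ξ => norm_nonneg _) hb (fun r hr => ?_)
  have : {ξ : EuclideanSpace ℝ (Fin d) | ‖ξ - q‖ ≤ r} = Metric.closedBall q r := by
    ext ξ; simp [dist_eq_norm]
  rw [this, Measure.addHaar_closedBall _ _ (by linarith), finrank_euclideanSpace_fin,
    mul_comm v.toReal, ENNReal.ofReal_mul (by positivity), ENNReal.ofReal_toReal hvt, Real.rpow_natCast]

/-- A bounded support lies in a single slab `|T_x e| ≤ R`, whose mass the growth condition bounds;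
`ℓ ≥ 1` supplies the unit vector `e`. -/
theorem measure_univ_lt_top_of_isCompact_support (hℓ : 1 ≤ ℓ)
    {lam : Measure (EuclideanSpace ℝ (Fin ℓ × Fin (n - ℓ)))} (hsupp : IsCompact lam.support)
    {c β : ℝ} (hlam : ∀ ξ : EuclideanSpace ℝ (Fin ℓ), ‖ξ‖ = 1 →
      ∀ p₂ : EuclideanSpace ℝ (Fin (n - ℓ)), ∀ r : ℝ, 0 < r →
        lam {x | ‖dualMap x ξ - p₂‖ ≤ r} ≤ ENNReal.ofReal (c * r ^ β)) :
    lam univ < ∞ := by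
  obtain ⟨R, hR0, hR⟩ := hsupp.isBounded.exists_pos_norm_le
  set e : EuclideanSpace ℝ (Fin ℓ) := EuclideanSpace.single ⟨0, hℓ⟩ 1 with he
  have he1 : ‖e‖ = 1 := by simp [he]
  calc lam univ = lam (lam.support ∪ lam.supportᶜ) := by rw [union_compl_self]
    _ ≤ lam lam.support + lam lam.supportᶜ := measure_union_le _ _
    _ = lam lam.support := by rw [Measure.measure_compl_support, add_zero]
    _ ≤ lam {x | ‖dualMap x e - 0‖ ≤ R} := measure_mono fun x hx => by
        have h1 := norm_dualMap_le x e
        rw [he1, mul_one] at h1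
        simpa using h1.trans (hR x hx)
    _ ≤ _ := hlam e he1 0 R hR0
    _ < ∞ := ENNReal.ofReal_lt_top

/-- For `|ξ| ≥ 1`, dividing by `|ξ|` reduces radius `r` to `r / |ξ|` in the growth condition, which
gains `|ξ|^(-β)`. For `|ξ| < 1` the weight `(1+|ξ|)^(-β)` is comparable to one and the total mass is
enough. -/
theorem lintegral_dualMap_gaussian_le
    {lam : Measure (EuclideanSpace ℝ (Fin ℓ × Fin (n - ℓ)))} [IsFiniteMeasure lam]
    {c β : ℝ} (hc : 0 < c) (hlam : ∀ ξ : EuclideanSpace ℝ (Fin ℓ), ‖ξ‖ = 1 →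
      ∀ p₂ : EuclideanSpace ℝ (Fin (n - ℓ)), ∀ r : ℝ, 0 < r →
        lam {x | ‖dualMap x ξ - p₂‖ ≤ r} ≤ ENNReal.ofReal (c * r ^ β)) {b : ℝ} (hb : 0 ≤ b) :
    ∃ C : ℝ≥0∞, C < ∞ ∧ ∀ (ξ : EuclideanSpace ℝ (Fin ℓ)) (q : EuclideanSpace ℝ (Fin (n - ℓ))),
      ∫⁻ x, ENNReal.ofReal ((1 + ‖dualMap x ξ - q‖) ^ b *
        Real.exp (-Real.pi * ‖dualMap x ξ - q‖ ^ 2)) ∂lam ≤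
      C * ENNReal.ofReal ((1 + ‖ξ‖) ^ (-β)) := by
  set Λ := lam.real univ with hΛ
  have hmeas : ∀ (ξ : EuclideanSpace ℝ (Fin ℓ)) (q : EuclideanSpace ℝ (Fin (n - ℓ))),
      Measurable fun x : EuclideanSpace ℝ (Fin ℓ × Fin (n - ℓ)) => ‖dualMap x ξ - q‖ := by
    intro ξ q
    have := continuous_dualMap (n := n) (ℓ := ℓ)
    exact Continuous.measurable (by fun_prop)
  refine ⟨ENNReal.ofReal (c * 2 ^ |β|) * gaussianSeries b β +
    ENNReal.ofReal (Λ * 2 ^ |β|) * gaussianSeries b 0, ENNReal.add_lt_top.2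
    ⟨ENNReal.mul_lt_top ENNReal.ofReal_lt_top (gaussianSeries_lt_top b β),
      ENNReal.mul_lt_top ENNReal.ofReal_lt_top (gaussianSeries_lt_top b 0)⟩, fun ξ q => ?_⟩
  have hξ0 := norm_nonneg ξ
  rw [add_mul]
  rcases le_or_gt 1 ‖ξ‖ with hξ | hξ
  · have hpos : 0 < ‖ξ‖ := by linarith
    refine le_trans ?_ (le_add_of_nonneg_right zero_le)
    refine (lintegral_gaussian_le lam (hmeas ξ q) (fun x => norm_nonneg _) hb
      (D := c * ‖ξ‖ ^ (-β)) (β := β) fun r hr => ?_).trans ?_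
    · have hr0 : 0 < r := by linarith
      have h1 := hlam (‖ξ‖⁻¹ • ξ) (by rw [norm_smul, norm_inv, norm_norm, inv_mul_cancel₀ hpos.ne'])
        (‖ξ‖⁻¹ • q) (‖ξ‖⁻¹ * r) (by positivity)
      have h2 : {x : EuclideanSpace ℝ (Fin ℓ × Fin (n - ℓ)) |
          ‖dualMap x (‖ξ‖⁻¹ • ξ) - ‖ξ‖⁻¹ • q‖ ≤ ‖ξ‖⁻¹ * r} = {x | ‖dualMap x ξ - q‖ ≤ r} := by
        ext x
        simp only [Set.mem_ofPred_eq]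
        rw [dualMap_smul, ← smul_sub, norm_smul, norm_inv, norm_norm,
          mul_le_mul_iff_of_pos_left (inv_pos.2 hpos)]
      rw [h2, Real.mul_rpow (by positivity) hr0.le, Real.inv_rpow hpos.le,
        ← Real.rpow_neg hpos.le, ← mul_assoc] at h1
      exact h1
    · have h1 : ‖ξ‖ ^ (-β) ≤ 2 ^ |β| * (1 + ‖ξ‖) ^ (-β) := by
        have := rpow_le_rpow_abs_mul hpos (show 0 < 1 + ‖ξ‖ by linarith) two_pos
          (by linarith) (by linarith) (-β)
        rwa [abs_neg] at this
      calc _ ≤ ENNReal.ofReal (c * (2 ^ |β| * (1 + ‖ξ‖) ^ (-β))) * gaussianSeries b β := by gcongr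
        _ = _ := by
          rw [← mul_assoc c, ENNReal.ofReal_mul (by positivity)]
          ring
  · refine le_trans ?_ (le_add_of_nonneg_left zero_le)
    refine (lintegral_gaussian_le lam (hmeas ξ q) (fun x => norm_nonneg _) hb
      (D := Λ) (β := 0) fun r hr => ?_).trans ?_
    · rw [Real.rpow_zero, mul_one, hΛ, measureReal_def, ENNReal.ofReal_toReal (measure_ne_top _ _)]
      exact measure_mono (subset_univ _)
    · have h1 : 1 ≤ 2 ^ |β| * (1 + ‖ξ‖) ^ (-β) := by
        have := rpow_le_rpow_abs_mul one_pos (show 0 < 1 + ‖ξ‖ by linarith) two_pos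
          (by linarith) (by linarith) (-β)
        rwa [abs_neg, Real.one_rpow] at this
      have hΛ0 : 0 ≤ Λ := measureReal_nonneg
      calc _ ≤ ENNReal.ofReal (Λ * (2 ^ |β| * (1 + ‖ξ‖) ^ (-β))) * gaussianSeries b 0 := by
            gcongr
            nlinarith
        _ = _ := by
          rw [← mul_assoc Λ, ENNReal.ofReal_mul (by positivity)]
          ring

/-- Pointwise control of the kernel by a product of the two slices. -/
theorem kernel_le (h : ℓ ≤ n) {R : ℝ} (hR : 0 ≤ R) (a β : ℝ)
    {x : EuclideanSpace ℝ (Fin ℓ × Fin (n - ℓ))} (hx : ‖x‖ ≤ R)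
    (ξ : EuclideanSpace ℝ (Fin ℓ)) (η : EuclideanSpace ℝ (Fin n)) :
    (1 + ‖ξ‖) ^ (a + β) * Real.exp (-Real.pi * ‖adjMap x ξ - η‖ ^ 2) ≤
      ((1 + R) ^ |a| * (1 + ‖η‖) ^ a) * (((1 + ‖ξ - headPart h η‖) ^ |a| *
        Real.exp (-Real.pi * ‖ξ - headPart h η‖ ^ 2)) * ((1 + ‖ξ‖) ^ β *
        ((1 + ‖dualMap x ξ - tailPart η‖) ^ |a| *
          Real.exp (-Real.pi * ‖dualMap x ξ - tailPart η‖ ^ 2)))) := by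
  set v := ‖ξ - headPart h η‖ with hv
  set u := ‖dualMap x ξ - tailPart η‖ with hu
  have hv0 : 0 ≤ v := norm_nonneg _
  have hu0 : 0 ≤ u := norm_nonneg _
  have hξ0 := norm_nonneg ξ
  have hη0 := norm_nonneg η
  have hsq : ‖adjMap x ξ - η‖ ^ 2 = v ^ 2 + u ^ 2 := by
    rw [norm_sq_split h, headPart_adjMap_sub, tailPart_adjMap_sub]
  have hηsq := norm_sq_split h η
  set η₁ := headPart h η
  set η₂ : EuclideanSpace ℝ (Fin (n - ℓ)) := tailPart η
  have h10 := norm_nonneg η₁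
  have h20 := norm_nonneg η₂
  have hη1 : ‖η₁‖ ≤ ‖η‖ := le_of_sq_le_sq (by nlinarith) hη0
  have hη2 : ‖η‖ ≤ ‖η₁‖ + ‖η₂‖ := le_of_sq_le_sq (by nlinarith) (by linarith)
  have e1 : ‖η₁‖ ≤ ‖ξ‖ + v := by
    have := norm_sub_norm_le η₁ ξ
    rw [norm_sub_rev] at this
    linarith
  have e2 : ‖ξ‖ ≤ ‖η₁‖ + v := by
    have := norm_sub_norm_le ξ η₁
    linarith
  have e3 : ‖η₂‖ ≤ R * ‖ξ‖ + u := by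
    have h1 := norm_sub_norm_le η₂ (dualMap x ξ)
    rw [norm_sub_rev] at h1
    have h2 := norm_dualMap_le x ξ
    have h3 : ‖x‖ * ‖ξ‖ ≤ R * ‖ξ‖ := by gcongr
    linarith
  -- `1 + |ξ|` and `1 + |η|` are each at most `Q` times the other, so their `a`-th powers can be
  -- exchanged for either sign of `a`. The loss `Q^|a|` is polynomial in `u` and `v`, so the
  -- Gaussians absorb it.
  set Q := (1 + R) * ((1 + v) * (1 + u)) with hQ
  have hQ0 : 0 < Q := by positivity
  have hRξ := mul_nonneg hR hξ0
  have hvu : 1 + v + u ≤ (1 + v) * (1 + u) := by nlinarith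
  have f1 : 1 + ‖η‖ ≤ Q * (1 + ‖ξ‖) := by
    have h1 : 1 + R * ‖ξ‖ + ‖ξ‖ ≤ (1 + R) * (1 + ‖ξ‖) := by nlinarith
    have h2 : (1 + R * ‖ξ‖ + ‖ξ‖) * (1 + v + u) ≤
        ((1 + R) * (1 + ‖ξ‖)) * ((1 + v) * (1 + u)) := by gcongr
    have h3 : 0 ≤ (R * ‖ξ‖ + ‖ξ‖) * (v + u) := by positivity
    rw [hQ]
    nlinarith
  have f2 : 1 + ‖ξ‖ ≤ Q * (1 + ‖η‖) := by
    have h1 : 1 + ‖ξ‖ ≤ (1 + ‖η‖) * (1 + v) := by nlinarith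
    have h2 : (1 : ℝ) ≤ (1 + R) * (1 + u) := by nlinarith
    calc 1 + ‖ξ‖ ≤ (1 + ‖η‖) * (1 + v) * 1 := by linarith
      _ ≤ (1 + ‖η‖) * (1 + v) * ((1 + R) * (1 + u)) := by gcongr
      _ = _ := by rw [hQ]; ring
  have hpow : (1 + ‖ξ‖) ^ a ≤ Q ^ |a| * (1 + ‖η‖) ^ a :=
    rpow_le_rpow_abs_mul (by linarith) (by linarith) hQ0 f2 f1 a
  have hQpow : Q ^ |a| = (1 + R) ^ |a| * ((1 + v) ^ |a| * (1 + u) ^ |a|) := by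
    rw [hQ, Real.mul_rpow (by positivity) (by positivity),
      Real.mul_rpow (by positivity) (by positivity)]
  have hexp : Real.exp (-Real.pi * ‖adjMap x ξ - η‖ ^ 2) =
      Real.exp (-Real.pi * v ^ 2) * Real.exp (-Real.pi * u ^ 2) := by
    rw [hsq, ← Real.exp_add]
    ring_nf
  rw [hexp, Real.rpow_add (by linarith)]
  calc _ ≤ (Q ^ |a| * (1 + ‖η‖) ^ a) * (1 + ‖ξ‖) ^ β *
        (Real.exp (-Real.pi * v ^ 2) * Real.exp (-Real.pi * u ^ 2)) := by gcongr
    _ = _ := by rw [hQpow]; ring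

theorem measurable_kernel (a : ℝ) : Measurable fun w : EuclideanSpace ℝ (Fin ℓ) ×
    (EuclideanSpace ℝ (Fin ℓ × Fin (n - ℓ)) × EuclideanSpace ℝ (Fin n)) =>
      ENNReal.ofReal ((1 + ‖w.1‖) ^ a * Real.exp (-Real.pi * ‖adjMap w.2.1 w.1 - w.2.2‖ ^ 2)) := by
  have h1 : Continuous fun w : EuclideanSpace ℝ (Fin ℓ) ×
      (EuclideanSpace ℝ (Fin ℓ × Fin (n - ℓ)) × EuclideanSpace ℝ (Fin n)) =>
      adjMap w.2.1 w.1 := continuous_adjMap.comp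
        ((continuous_fst.comp continuous_snd).prodMk continuous_fst)
  have h2 : Continuous fun w : EuclideanSpace ℝ (Fin ℓ) ×
      (EuclideanSpace ℝ (Fin ℓ × Fin (n - ℓ)) × EuclideanSpace ℝ (Fin n)) =>
      (1 + ‖w.1‖) ^ a := Continuous.rpow_const (by fun_prop) fun w => Or.inl (by positivity)
  exact (Continuous.measurable (by fun_prop)).ennreal_ofReal

/-- The averaged kernel is dominated by a power of `1 + ‖η‖`. -/
theorem lintegral_kernel_le (h : ℓ ≤ n)
    {lam : Measure (EuclideanSpace ℝ (Fin ℓ × Fin (n - ℓ)))} [IsFiniteMeasure lam]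
    (hsupp : IsCompact lam.support)
    {c β : ℝ} (hc : 0 < c) (hlam : ∀ ξ : EuclideanSpace ℝ (Fin ℓ), ‖ξ‖ = 1 →
      ∀ p₂ : EuclideanSpace ℝ (Fin (n - ℓ)), ∀ r : ℝ, 0 < r →
        lam {x | ‖dualMap x ξ - p₂‖ ≤ r} ≤ ENNReal.ofReal (c * r ^ β)) (a : ℝ) :
    ∃ C : ℝ≥0∞, C < ∞ ∧ ∀ η : EuclideanSpace ℝ (Fin n),
      ∫⁻ ξ : EuclideanSpace ℝ (Fin ℓ), ∫⁻ x, ENNReal.ofReal ((1 + ‖ξ‖) ^ (a + β) *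
        Real.exp (-Real.pi * ‖adjMap x ξ - η‖ ^ 2)) ∂lam ≤ C * ENNReal.ofReal ((1 + ‖η‖) ^ a) := by
  obtain ⟨R, hR0, hR⟩ := hsupp.isBounded.exists_pos_norm_le
  obtain ⟨V, hV, hV'⟩ := lintegral_volume_gaussian_le (d := ℓ) (abs_nonneg a)
  obtain ⟨C, hC, hC'⟩ := lintegral_dualMap_gaussian_le hc hlam (abs_nonneg a)
  refine ⟨ENNReal.ofReal ((1 + R) ^ |a|) * (C * V), ENNReal.mul_lt_top ENNReal.ofReal_lt_top
    (ENNReal.mul_lt_top hC hV), fun η => ?_⟩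
  set A : ℝ := (1 + R) ^ |a| * (1 + ‖η‖) ^ a with hA
  have hA0 : 0 ≤ A := by positivity
  set g : EuclideanSpace ℝ (Fin ℓ) → ℝ := fun ξ => (1 + ‖ξ - headPart h η‖) ^ |a| *
    Real.exp (-Real.pi * ‖ξ - headPart h η‖ ^ 2) with hg
  have hg0 : ∀ ξ, 0 ≤ g ξ := fun ξ => by simp only [hg]; positivity
  have hinner : ∀ ξ : EuclideanSpace ℝ (Fin ℓ), ∫⁻ x, ENNReal.ofReal ((1 + ‖ξ‖) ^ (a + β) *
      Real.exp (-Real.pi * ‖adjMap x ξ - η‖ ^ 2)) ∂lam ≤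
      ENNReal.ofReal A * C * ENNReal.ofReal (g ξ) := by
    intro ξ
    have hξ0 : 0 < 1 + ‖ξ‖ := by positivity
    calc _ ≤ ∫⁻ x, ENNReal.ofReal (A * (g ξ * (1 + ‖ξ‖) ^ β)) *
          ENNReal.ofReal ((1 + ‖dualMap x ξ - tailPart η‖) ^ |a| *
            Real.exp (-Real.pi * ‖dualMap x ξ - tailPart η‖ ^ 2)) ∂lam := by
          refine lintegral_mono_ae ?_
          -- The support has full measure, so `‖x‖ ≤ R` almost everywhere.
          filter_upwards [Measure.support_mem_ae (μ := lam)] with x hx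
          rw [← ENNReal.ofReal_mul (mul_nonneg hA0 (mul_nonneg (hg0 ξ) (by positivity)))]
          refine ENNReal.ofReal_le_ofReal ((kernel_le h hR0.le a β (hR x hx) ξ η).trans_eq ?_)
          simp only [hA, hg]
          ring
      _ ≤ ENNReal.ofReal (A * (g ξ * (1 + ‖ξ‖) ^ β)) *
          (C * ENNReal.ofReal ((1 + ‖ξ‖) ^ (-β))) := by
          rw [lintegral_const_mul' _ _ ENNReal.ofReal_ne_top]
          gcongr
          exact hC' ξ (tailPart η)
      _ = ENNReal.ofReal A * C * (ENNReal.ofReal (g ξ) *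
          (ENNReal.ofReal ((1 + ‖ξ‖) ^ β) * ENNReal.ofReal ((1 + ‖ξ‖) ^ (-β)))) := by
          rw [ENNReal.ofReal_mul hA0, ENNReal.ofReal_mul (hg0 ξ)]
          ring
      _ = _ := by
          rw [← ENNReal.ofReal_mul (by positivity), ← Real.rpow_add hξ0, add_neg_cancel,
            Real.rpow_zero, ENNReal.ofReal_one, mul_one]
  calc _ ≤ ∫⁻ ξ, ENNReal.ofReal A * C * ENNReal.ofReal (g ξ) := lintegral_mono hinner
    _ ≤ ENNReal.ofReal A * C * V := by
        rw [lintegral_const_mul' _ _ (ENNReal.mul_lt_top ENNReal.ofReal_lt_top hC).ne]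
        gcongr
        exact hV' _
    _ = _ := by
        rw [hA, ENNReal.ofReal_mul (by positivity)]
        ring

end KernelEstimate

/-! ### Averaging the Sobolev energies over `x`. -/

section Average

variable {n ℓ : ℕ}

/-- Tonelli's theorem for moving the outermost weight out of a triple integral. -/
theorem lintegral_lintegral_lintegral_mul {A B C : Type*} [MeasurableSpace A] [MeasurableSpace B]
    [MeasurableSpace C] {μA : Measure A} {μB : Measure B} {μC : Measure C} [SFinite μA]
    [SFinite μB] [SFinite μC] {m : C → ℝ≥0∞} (hm : Measurable m) (hmt : ∀ c, m c ≠ ∞)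
    {k : A × (B × C) → ℝ≥0∞} (hk : Measurable k) :
    ∫⁻ a, ∫⁻ b, (∫⁻ c, m c * k (a, b, c) ∂μC) ∂μB ∂μA =
      ∫⁻ c, m c * ∫⁻ a, ∫⁻ b, k (a, b, c) ∂μB ∂μA ∂μC := by
  have h1 : ∀ a, ∫⁻ b, (∫⁻ c, m c * k (a, b, c) ∂μC) ∂μB =
      ∫⁻ c, m c * ∫⁻ b, k (a, b, c) ∂μB ∂μC := by
    intro a
    have : Measurable fun z : B × C => m z.2 * k (a, z.1, z.2) := by fun_prop
    rw [lintegral_lintegral_swap this.aemeasurable]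
    exact lintegral_congr fun c => lintegral_const_mul' _ _ (hmt c)
  simp_rw [h1]
  have h2 : Measurable fun z : A × C => ∫⁻ b, k (z.1, b, z.2) ∂μB := by
    have : Measurable fun w : (A × C) × B => k (w.1.1, w.2, w.1.2) := by fun_prop
    exact this.lintegral_prod_right'
  have h3 : Measurable fun z : A × C => m z.2 * ∫⁻ b, k (z.1, b, z.2) ∂μB :=
    (hm.comp measurable_snd).mul h2
  rw [lintegral_lintegral_swap h3.aemeasurable]
  exact lintegral_congr fun c => lintegral_const_mul' _ _ (hmt c)

/-- The Sobolev energies of the projections of the cut-off measure have finite average. -/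
theorem lintegral_sobolev_energy_lt_top (h : ℓ ≤ n)
    {lam : Measure (EuclideanSpace ℝ (Fin ℓ × Fin (n - ℓ)))} [IsFiniteMeasure lam]
    (hsupp : IsCompact lam.support)
    {c β : ℝ} (hc : 0 < c) (hlam : ∀ ξ : EuclideanSpace ℝ (Fin ℓ), ‖ξ‖ = 1 →
      ∀ p₂ : EuclideanSpace ℝ (Fin (n - ℓ)), ∀ r : ℝ, 0 < r →
        lam {x | ‖dualMap x ξ - p₂‖ ≤ r} ≤ ENNReal.ofReal (c * r ^ β)) {a : ℝ}
    (μ : Measure (EuclideanSpace ℝ (Fin n))) [IsFiniteMeasure μ]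
    (hμ : ∫⁻ η, ENNReal.ofReal ((1 + ‖η‖) ^ a) * ENNReal.ofReal (‖measureFourier μ η‖ ^ 2) < ∞) :
    ∫⁻ x, (∫⁻ ξ : EuclideanSpace ℝ (Fin ℓ), ENNReal.ofReal ((1 + ‖ξ‖) ^ (a + β)) *
      ENNReal.ofReal (‖measureFourier (gaussianCutoff μ) (adjMap x ξ)‖ ^ 2)) ∂lam < ∞ := by
  obtain ⟨C, hC, hC'⟩ := lintegral_kernel_le h hsupp hc hlam a
  have := isFiniteMeasure_gaussianCutoff μ
  set k : EuclideanSpace ℝ (Fin ℓ) → EuclideanSpace ℝ (Fin ℓ × Fin (n - ℓ)) →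
      EuclideanSpace ℝ (Fin n) → ℝ≥0∞ := fun ξ x η =>
    ENNReal.ofReal ((1 + ‖ξ‖) ^ (a + β) * Real.exp (-Real.pi * ‖adjMap x ξ - η‖ ^ 2)) with hk
  have hkm := measurable_kernel (n := n) (ℓ := ℓ) (a + β)
  set m : EuclideanSpace ℝ (Fin n) → ℝ≥0∞ := fun η =>
    ENNReal.ofReal (‖measureFourier μ η‖ ^ 2) with hm
  have hmm : Measurable m := ((continuous_measureFourier μ).norm.pow 2).measurable.ennreal_ofReal
  have hmt : ∀ η, m η ≠ ∞ := fun η => ENNReal.ofReal_ne_top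
  have hle : ∀ ξ x, ENNReal.ofReal ((1 + ‖ξ‖) ^ (a + β)) *
      ENNReal.ofReal (‖measureFourier (gaussianCutoff μ) (adjMap x ξ)‖ ^ 2) ≤
      ∫⁻ η, m η * k ξ x η := by
    intro ξ x
    refine (mul_le_mul_right (norm_measureFourier_gaussianCutoff_sq_le μ (adjMap x ξ)) _).trans ?_
    rw [← lintegral_const_mul' _ _ ENNReal.ofReal_ne_top]
    refine lintegral_mono fun η => le_of_eq ?_
    simp only [hm, hk]
    rw [← ENNReal.ofReal_mul (by positivity), ← ENNReal.ofReal_mul (by positivity)]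
    congr 1
    ring
  calc _ = ∫⁻ ξ : EuclideanSpace ℝ (Fin ℓ), ∫⁻ x, ENNReal.ofReal ((1 + ‖ξ‖) ^ (a + β)) *
      ENNReal.ofReal (‖measureFourier (gaussianCutoff μ) (adjMap x ξ)‖ ^ 2) ∂lam := by
        refine lintegral_lintegral_swap (Measurable.aemeasurable ?_)
        have h1 : Continuous fun z : EuclideanSpace ℝ (Fin ℓ × Fin (n - ℓ)) ×
            EuclideanSpace ℝ (Fin ℓ) => measureFourier (gaussianCutoff μ) (adjMap z.1 z.2) :=
          (continuous_measureFourier _).comp continuous_adjMap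
        have h2 : Continuous fun z : EuclideanSpace ℝ (Fin ℓ × Fin (n - ℓ)) ×
            EuclideanSpace ℝ (Fin ℓ) => (1 + ‖z.2‖) ^ (a + β) :=
          Continuous.rpow_const (by fun_prop) fun z => Or.inl (by positivity)
        exact h2.measurable.ennreal_ofReal.mul (h1.norm.pow 2).measurable.ennreal_ofReal
    _ ≤ ∫⁻ ξ, ∫⁻ x, (∫⁻ η, m η * k ξ x η) ∂lam :=
        lintegral_mono fun ξ => lintegral_mono fun x => hle ξ x
    _ = ∫⁻ η, m η * ∫⁻ ξ, ∫⁻ x, k ξ x η ∂lam :=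
        lintegral_lintegral_lintegral_mul hmm hmt hkm
    _ ≤ ∫⁻ η, C * (ENNReal.ofReal ((1 + ‖η‖) ^ a) * m η) := by
        refine lintegral_mono fun η => ?_
        calc m η * _ ≤ m η * (C * ENNReal.ofReal ((1 + ‖η‖) ^ a)) := by gcongr; exact hC' η
          _ = _ := by ring
    _ < ∞ := by
        rw [lintegral_const_mul' _ _ hC.ne]
        exact ENNReal.mul_lt_top hC hμ

theorem measureFourier_smul (c : ℝ≥0∞) (ν : Measure (EuclideanSpace ℝ (Fin ℓ)))
    (ξ : EuclideanSpace ℝ (Fin ℓ)) :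
    measureFourier (c • ν) ξ = c.toReal • measureFourier ν ξ :=
  integral_smul_measure _ _

/-- A finite nonzero measure of finite Sobolev energy on a compact subset witnesses the Sobolev
dimension. -/
theorem sobolevDimGE_of_measure {F K : Set (EuclideanSpace ℝ (Fin ℓ))} (hKF : K ⊆ F) {σ : ℝ}
    (ν : Measure (EuclideanSpace ℝ (Fin ℓ))) [IsFiniteMeasure ν] (hν : ν univ ≠ 0)
    (hνK : ν Kᶜ = 0)
    (hfin : ∫⁻ ξ : EuclideanSpace ℝ (Fin ℓ), ENNReal.ofReal ((1 + ‖ξ‖) ^ (σ - ℓ)) *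
      ENNReal.ofReal (‖measureFourier ν ξ‖ ^ 2) < ∞) : SobolevDimGE F σ := by
  have : NeZero ν := ⟨fun h => hν (by simp [h])⟩
  refine ⟨(ν univ)⁻¹ • ν, isProbabilityMeasureSMul, ?_, ?_⟩
  · rw [Measure.smul_apply, measure_mono_null (compl_subset_compl.2 hKF) hνK, smul_zero]
  · set m := ((ν univ)⁻¹).toReal with hm
    calc _ = ∫⁻ ξ : EuclideanSpace ℝ (Fin ℓ), ENNReal.ofReal (m ^ 2) *
          (ENNReal.ofReal ((1 + ‖ξ‖) ^ (σ - ℓ)) * ENNReal.ofReal (‖measureFourier ν ξ‖ ^ 2)) := by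
          refine lintegral_congr fun ξ => ?_
          rw [measureFourier_smul, norm_smul, ← hm, Real.norm_of_nonneg ENNReal.toReal_nonneg,
            ← ENNReal.ofReal_mul (by positivity), ← ENNReal.ofReal_mul (by positivity),
            ← neg_sub (ℓ : ℝ) σ, Real.rpow_neg (by positivity)]
          congr 1
          rw [div_eq_mul_inv]
          ring
      _ < ∞ := by
          rw [lintegral_const_mul' _ _ ENNReal.ofReal_ne_top]
          exact ENNReal.mul_lt_top ENNReal.ofReal_lt_top hfin

end Average

end ExceptionalProj

end

/-! ### Assembly: finite average energy gives almost every projection. -/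

theorem theorem2 (n ℓ : ℕ) (hℓ : 1 ≤ ℓ) (hn : ℓ < n) (α β σ : ℝ)
    (lam : Measure (EuclideanSpace ℝ (Fin ℓ × Fin (n - ℓ))))
    (hsupp : IsCompact lam.support)
    (hlam : ∃ c : ℝ, 0 < c ∧ ∀ ξ : EuclideanSpace ℝ (Fin ℓ), ‖ξ‖ = 1 →
      ∀ p₂ : EuclideanSpace ℝ (Fin (n - ℓ)), ∀ r : ℝ, 0 < r →
        lam {x | ‖ExceptionalProj.dualMap x ξ - p₂‖ ≤ r} ≤ ENNReal.ofReal (c * r ^ β))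
    (E : Set (EuclideanSpace ℝ (Fin n))) (hE : MeasurableSet E) (hE_ne : E.Nonempty)
    (hα : ENNReal.ofReal α ≤ dimH E)
    (hσ : (n : ℝ) - (ℓ : ℝ) + σ - α < β) :
    ∀ᵐ x ∂lam, ExceptionalProj.SobolevDimGE (ExceptionalProj.projMap hn.le x '' E) σ := by
  open ExceptionalProj in
  obtain ⟨c, hc, hlam⟩ := hlam
  have : IsFiniteMeasure lam := ⟨measure_univ_lt_top_of_isCompact_support hℓ hsupp hlam⟩
  -- With this `a`, the exponent `a + β` is the Sobolev weight `σ - ℓ`, and `hσ` says exactly `a + n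
  -- < α`.
  set a : ℝ := σ - ℓ - β with ha
  obtain ⟨s, hs1, hs2⟩ := exists_between (show a + n < α by rw [ha]; linarith)
  obtain ⟨t, hst, K, hKE, hK, μ, hμ, hμK, D, hD⟩ :=
    exists_measure_prod_dist_le hE hE_ne hs2 hα
  have hfin := lintegral_fourier_energy_lt_top μ (lt_of_lt_of_le hs1 hst) hD
  have htotal := lintegral_sobolev_energy_lt_top hn.le hsupp hc hlam μ hfin
  have := isFiniteMeasure_gaussianCutoff μ
  have haβ : a + β = σ - ℓ := by rw [ha]; ring
  rw [haβ] at htotal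
  have hmeas : AEMeasurable (fun x : EuclideanSpace ℝ (Fin ℓ × Fin (n - ℓ)) =>
      ∫⁻ ξ : EuclideanSpace ℝ (Fin ℓ), ENNReal.ofReal ((1 + ‖ξ‖) ^ (σ - ℓ)) *
        ENNReal.ofReal (‖measureFourier (gaussianCutoff μ) (adjMap x ξ)‖ ^ 2)) lam := by
    refine (Measurable.lintegral_prod_right' (ν := volume)
      (f := fun z : EuclideanSpace ℝ (Fin ℓ × Fin (n - ℓ)) × EuclideanSpace ℝ (Fin ℓ) =>
        ENNReal.ofReal ((1 + ‖z.2‖) ^ (σ - ℓ)) *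
          ENNReal.ofReal (‖measureFourier (gaussianCutoff μ) (adjMap z.1 z.2)‖ ^ 2)) ?_).aemeasurable
    have h1 := (continuous_measureFourier (gaussianCutoff μ)).comp
      (continuous_adjMap (n := n) (ℓ := ℓ))
    have h2 : Continuous fun z : EuclideanSpace ℝ (Fin ℓ × Fin (n - ℓ)) ×
        EuclideanSpace ℝ (Fin ℓ) => (1 + ‖z.2‖) ^ (σ - ℓ) :=
      Continuous.rpow_const (by fun_prop) fun z => Or.inl (by positivity)
    exact h2.measurable.ennreal_ofReal.mul (h1.norm.pow 2).measurable.ennreal_ofReal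
  filter_upwards [ae_lt_top' hmeas htotal.ne] with x hx
  have hP := continuous_projMap hn.le x
  refine sobolevDimGE_of_measure (Set.image_mono hKE) ((gaussianCutoff μ).map (projMap hn.le x))
    ?_ ?_ ?_
  · rw [Measure.map_apply hP.measurable MeasurableSet.univ, Set.preimage_univ]
    exact gaussianCutoff_univ_ne_zero μ (IsProbabilityMeasure.ne_zero μ)
  -- The image of `E` need not be Borel, so concentration is checked on the compact image of `K`;
  -- the cutoff is absolutely continuous with respect to `μ` and so still vanishes off `K`.
  · rw [Measure.map_apply hP.measurable (hK.image hP).measurableSet.compl]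
    refine measure_mono_null (t := Kᶜ) (fun p hp hpK => hp ⟨p, hpK, rfl⟩) ?_
    exact withDensity_absolutelyContinuous _ _ hμK
  · simp_rw [measureFourier_map_projMap]
    exact hx
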